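/- Write $C^0(\mathbb R^2)$ for the bounded continuous vector fields on $\mathbb R^2$ with the sup norm; let $\|f\|_{C^0}=\sup|f|$, and $\|f\|_{C^\alpha}=\sup|f|+\sup_{x\ne y}\frac{|f(x)-f(y)|}{|x-y|^\alpha}$ for $\alpha\in(0,1)$. For a drift $u\in L^1([0,1],C^0(\mathbb R^2))$, a path $W\in C^0([0,1],\mathbb R^2)$, $y\in\mathbb R^2$ and $\varepsilon\in(0,1]$, a Carathéodory solution on $[0,\varepsilon]$ of $$dX_t=u(t,X_t)\,dt+dW_t,\qquad X_0=y \qquad (*)$$ is a path $X\in C^0([0,\varepsilon],\mathbb R^2)$ with $X_t=y+\int_0^t u(s,X_s)\,ds+W_t-W_0$ for all $t\in[0,\varepsilon]$. If $W$ is random, path-by-path uniqueness on $[0,\varepsilon]$ means that for almost every realization of $W$ there is exactly one Carathéodory solution of $(*)$ on $[0,\varepsilon]$. **Corollary.** For every $\alpha\in[0,1/2)$ there exists a random velocity field $u:[0,1]\times\mathbb R^2\to\mathbb R^2$ (jointly measurable in the random parameter, $t$ and $x$, every realization lying in $L^1([0,1],C^0(\mathbb R^2))$) such that surely $\|u(t,\cdot)\|_{C^\alpha(\mathbb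 R^2)}\le 2$ for all $t\in[0,1]$, and: 1. For every $\beta$ with $\frac{1}{2(1-\alpha)}<\beta\le 1$, every deterministic $\beta$-Hölder path $W:[0,1]\to\mathbb R^2$ and every $y\in\mathbb R^2$, almost surely in $u$, the ODE $(*)$ has at least two distinct Carathéodory solutions on $[0,\varepsilon]$ for every $\varepsilon\in(0,1]$. 2. In particular, path-by-path uniqueness fails for fractional Brownian motion: for every $H\in(0,1)$ with $\alpha<1-\frac1{2H}$ and every $y\in\mathbb R^2$, almost surely in $u$, if $(*)$ is driven by an independent two-dimensional fractional Brownian motion with Hurst parameter $H$ (the continuous centered Gaussian process on $[0,1]$ with $\mathbb E[W_{t,i}W_{s,j}]=\frac12\delta_{ij}(t^{2H}+s^{2H}-|t-s|^{2H})$), then path-by-path uniqueness does not hold on $[0,\varepsilon]$ for any $\varepsilon\in(0,1]$. -/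

import Mathlib

open MeasureTheory ProbabilityTheory Set
open scoped NNReal ENNReal BoundedContinuousFunction

noncomputable section

/-- Euclidean space `ℝᵈ` with the Euclidean norm. -/
abbrev Space (d : ℕ) : Type := EuclideanSpace ℝ (Fin d)

/-- The path space `C⁰([0,T], ℝᵈ)`. -/
abbrev Path0 (d : ℕ) (T : ℝ≥0) : Type := C(Icc (0 : ℝ) T, Space d)

/-- Path space carries the Borel σ-algebra of the uniform topology. -/
instance instMeasurableSpacePath0 (d : ℕ) (T : ℝ≥0) : MeasurableSpace (Path0 d T) := borel _

instance instBorelSpacePath0 (d : ℕ) (T : ℝ≥0) : BorelSpace (Path0 d T) := ⟨rfl⟩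

/-- The initial time `0`, as a point of `[0,T]`. -/
def startTime (T : ℝ≥0) : Icc (0 : ℝ) T := ⟨0, le_refl 0, T.2⟩

/-- The restriction map `C⁰([0,T], ℝᵈ) → C⁰([0,ε], ℝᵈ)`, for `ε ≤ T`. -/
def restrictPath {d : ℕ} {T ε : ℝ≥0} (h : ε ≤ T) (W : Path0 d T) : Path0 d ε :=
  W.comp ⟨inclusion (Icc_subset_Icc_right (NNReal.coe_le_coe.mpr h)), continuous_inclusion _⟩

/-- The usual Hölder norm `‖f‖_{C^α}`: the sup norm if `α = 0`, and the sup norm plus the `α`-Hölder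
seminorm if `α ∈ (0,1)`. It takes the value `∞` when `f` is not in the space. -/
def holderNorm {d : ℕ} (α : ℝ≥0) (f : Space d → Space d) : ℝ≥0∞ :=
  (⨆ x, ‖f x‖ₑ) + if α = 0 then 0 else eHolderNorm α f

/-- `u ∈ L¹([0,T], C⁰(ℝᵈ))`, where `C⁰(ℝᵈ)` is the Banach space of bounded continuous vector fields
with the sup norm. Only the values `u t` with `t ∈ [0,T]` matter. -/
def MemL1C0 {d : ℕ} (T : ℝ≥0) (u : ℝ → (Space d →ᵇ Space d)) : Prop :=
  IntegrableOn u (Icc (0 : ℝ) T) volume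

/-- A random velocity field on `[0,T] × ℝᵈ`, defined on `Ω`: it is jointly measurable in `(ω, t, x)`
and each of its realizations is a drift in `L¹([0,T], C⁰(ℝᵈ))`. -/
structure IsRandomVelocityField {Ω : Type} [MeasurableSpace Ω] {d : ℕ} (T : ℝ≥0)
    (u : Ω → ℝ → (Space d →ᵇ Space d)) : Prop where
  measurable : Measurable fun p : Ω × ℝ × Space d => u p.1 p.2.1 p.2.2
  memL1C0 : ∀ ω, MemL1C0 T (u ω)

/-- `X ∈ C⁰([0,T], ℝᵈ)` is a Carathéodory solution of `dX = u(t,X) dt + dW`, `X_0 = y`: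
`X_t = y + ∫₀ᵗ u(s, X_s) ds + W_t - W_0` for all `t ∈ [0,T]`. For a drift in `L¹([0,T], C⁰(ℝᵈ))`,
the only kind to which this is applied, the integrand is automatically integrable. (`IccExtend`
only turns `X` into a function on the real line; it agrees with `X` on `[0,T]`.) -/
def IsCaratheodorySolution {d : ℕ} {T : ℝ≥0} (u : ℝ → (Space d →ᵇ Space d)) (y : Space d)
    (W X : Path0 d T) : Prop :=
  ∀ t : Icc (0 : ℝ) T,
    X t = y + (∫ s in (0 : ℝ)..t, u s (IccExtend T.2 X s)) + W t - W (startTime T)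

/-- The ODE driven by the path `W` has at least two distinct Carathéodory solutions on `[0,T]`. -/
def HasNonuniqueSolutions {d : ℕ} {T : ℝ≥0} (u : ℝ → (Space d →ᵇ Space d)) (y : Space d)
    (W : Path0 d T) : Prop :=
  ∃ X₁ X₂ : Path0 d T,
    IsCaratheodorySolution u y W X₁ ∧ IsCaratheodorySolution u y W X₂ ∧ X₁ ≠ X₂

/-- Path-by-path uniqueness: for almost every realization `W` of the driving noise, whose law is
`ν`, there is a unique Carathéodory solution. -/
def PathByPathUniqueness {d : ℕ} {T : ℝ≥0} (u : ℝ → (Space d →ᵇ Space d)) (y : Space d)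
    (ν : Measure (Path0 d T)) : Prop :=
  ∀ᵐ W ∂ν, ∃! X : Path0 d T, IsCaratheodorySolution u y W X

/-- `ν` is the law on `C⁰([0,T], ℝᵈ)` of `d`-dimensional fractional Brownian motion with Hurst
parameter `H`: the coordinate process is a centered Gaussian process with covariance
`E[W_{t,i} W_{s,j}] = δ_{ij} (t^{2H} + s^{2H} - |t-s|^{2H}) / 2`. -/
structure IsFractionalBrownianLaw {d : ℕ} {T : ℝ≥0} (H : ℝ) (ν : Measure (Path0 d T)) : Prop where
  isProbabilityMeasure : IsProbabilityMeasure ν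
  isGaussianProcess :
    IsGaussianProcess (fun (t : Icc (0 : ℝ) T) (W : Path0 d T) => W t) ν
  centered : ∀ (t : Icc (0 : ℝ) T) (i : Fin d), ∫ W : Path0 d T, W t i ∂ν = 0
  covariance : ∀ (t s : Icc (0 : ℝ) T) (i j : Fin d),
    ∫ W : Path0 d T, W t i * W s j ∂ν =
      if i = j then ((t : ℝ) ^ (2 * H) + (s : ℝ) ^ (2 * H) - |(t : ℝ) - s| ^ (2 * H)) / 2 else 0

end

/-!
The velocity field consists of random shears, alternating in direction, whose length scales decay
faster than any power of `t` as `t → 0`. Consider two trajectories that enter stage `n` well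
separated in the direction transverse to its shears. In each of the `N` time blocks of the stage,
flipping the sign at the node nearest to the first trajectory changes the displacement of that
trajectory much more than that of the second one, provided the driving path is regular enough to
stay near the node. The separation gained during the stage is therefore a sum of `N` independent
signed terms, and by the Littlewood–Offord bound it fails to reach the larger scale required by the
next stage with probability of order `N ^ (-1/2)` times a ratio of scales. For `α < 1/2` these
probabilities are summable, so two solutions of the equation with the drift switched on late,
started at nearby points, are separated at the end of stage `n` with a probability that tends to `1`
as `n → ∞`, uniformly in the time of switching on. Switching the drift on ever earlier and letting
the starting points merge, Arzelà–Ascoli gives two solutions that differ at arbitrarily small times.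
For fractional Brownian motion one exchanges the two almost sure quantifiers.
-/

noncomputable section

section AntiConcentration

variable {ι : Type*} [Fintype ι]

/-- The sign `±1` encoded by a Boolean. -/
def signOf (b : Bool) : ℝ := if b then 1 else -1

lemma abs_signOf (b : Bool) : |signOf b| = 1 := by cases b <;> simp [signOf]

lemma signOf_xor (a b : Bool) : signOf (xor a b) = -(signOf a * signOf b) := by
  cases a <;> cases b <;> simp [signOf]

lemma signOf_injective : Function.Injective signOf := by
  intro a b
  cases a <;> cases b <;> norm_num [signOf]

/-- The indices of the positive terms of a signed sum. This set encodes the choice `e` of signs when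
all the `b i` are nonzero. -/
def positiveTerms (b : ι → ℝ) (e : ι → Bool) : Finset ι := {i | 0 < signOf (e i) * b i}

lemma signOf_mul_of_mem_positiveTerms {b : ι → ℝ} {e : ι → Bool} {i : ι}
    (h : i ∈ positiveTerms b e) : signOf (e i) * b i = |b i| := by
  rw [positiveTerms, Finset.mem_filter_univ] at h
  rw [← abs_of_pos h, abs_mul, abs_signOf, one_mul]

lemma signOf_mul_of_notMem_positiveTerms {b : ι → ℝ} {e : ι → Bool} {i : ι}
    (h : i ∉ positiveTerms b e) : signOf (e i) * b i = -|b i| := by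
  rw [positiveTerms, Finset.mem_filter_univ, not_lt] at h
  rw [← neg_eq_iff_eq_neg, ← abs_of_nonpos h, abs_mul, abs_signOf, one_mul]

lemma positiveTerms_injective {b : ι → ℝ} (hb : ∀ i, b i ≠ 0) :
    Function.Injective (positiveTerms b) := by
  intro e e' h
  funext i
  refine signOf_injective (mul_right_cancel₀ (hb i) ?_)
  by_cases hi : i ∈ positiveTerms b e
  · rw [signOf_mul_of_mem_positiveTerms hi, signOf_mul_of_mem_positiveTerms (h ▸ hi)]
  · rw [signOf_mul_of_notMem_positiveTerms hi, signOf_mul_of_notMem_positiveTerms (h ▸ hi)]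

lemma sum_signOf_mul_eq (b : ι → ℝ) (e : ι → Bool) :
    ∑ i, signOf (e i) * b i = 2 * ∑ i ∈ positiveTerms b e, |b i| - ∑ i, |b i| := by
  classical
  have hterm (i : ι) :
      signOf (e i) * b i = (if i ∈ positiveTerms b e then 2 * |b i| else 0) - |b i| := by
    split_ifs with hi
    · rw [signOf_mul_of_mem_positiveTerms hi]; ring
    · rw [signOf_mul_of_notMem_positiveTerms hi, zero_sub]
  simp_rw [hterm, Finset.sum_sub_distrib, Finset.sum_ite_mem, Finset.univ_inter, Finset.mul_sum]

lemma sum_signOf_mul_add_le_of_ssubset {b : ι → ℝ} {a : ℝ} (hb : ∀ i, a ≤ |b i|)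
    {e e' : ι → Bool} (h : positiveTerms b e ⊂ positiveTerms b e') :
    ∑ i, signOf (e i) * b i + 2 * a ≤ ∑ i, signOf (e' i) * b i := by
  classical
  obtain ⟨j, hj', hj⟩ := Finset.exists_of_ssubset h
  have hinsert : |b j| + ∑ i ∈ positiveTerms b e, |b i| ≤ ∑ i ∈ positiveTerms b e', |b i| := by
    rw [← Finset.sum_insert (f := fun i => |b i|) hj]
    exact Finset.sum_le_sum_of_subset_of_nonneg (Finset.insert_subset hj' h.subset)
      fun _ _ _ => abs_nonneg _
  rw [sum_signOf_mul_eq, sum_signOf_mul_eq]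
  linarith [hb j]

/-- The Littlewood–Offord bound, following Erdős: the sets of positive terms of the sums that lie in
a short interval form an antichain. -/
lemma card_sum_signOf_mul_mem_Ico_le [DecidableEq ι] (b : ι → ℝ) {a : ℝ} (ha : 0 < a)
    (hb : ∀ i, a ≤ |b i|) (x : ℝ) :
    Finset.card {e : ι → Bool | ∑ i, signOf (e i) * b i ∈ Ico x (x + 2 * a)} ≤
      (Fintype.card ι).choose (Fintype.card ι / 2) := by
  have hb0 (i : ι) : b i ≠ 0 := abs_pos.1 (ha.trans_le (hb i))
  rw [← Finset.card_map ⟨positiveTerms b, positiveTerms_injective hb0⟩]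
  apply IsAntichain.sperner
  rintro _ hs _ hs' hne hsub
  simp only [Finset.coe_map, Finset.coe_filter, Finset.mem_univ, true_and, Set.mem_image,
    Set.mem_ofPred_eq, Function.Embedding.coeFn_mk] at hs hs'
  obtain ⟨e, he, rfl⟩ := hs
  obtain ⟨e', he', rfl⟩ := hs'
  have hgap := sum_signOf_mul_add_le_of_ssubset hb (lt_of_le_of_ne hsub hne)
  linarith [he.1, he'.2]

lemma exists_nat_mem_Ico_of_abs_lt {a s R L : ℝ} (ha : 0 < a) (hs : |R + s| < L) :
    ∃ k < ⌈L / a⌉₊, s ∈ Ico (-R - L + 2 * a * k) (-R - L + 2 * a * k + 2 * a) := by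
  obtain ⟨hlower, hupper⟩ := abs_lt.1 hs
  have hpos : 0 ≤ (s + R + L) / (2 * a) := div_nonneg (by linarith) (by linarith)
  have hfloor := Nat.floor_le hpos
  have hfloor' := Nat.lt_floor_add_one ((s + R + L) / (2 * a))
  rw [le_div_iff₀ (by linarith)] at hfloor
  rw [div_lt_iff₀ (by linarith)] at hfloor'
  refine ⟨⌊(s + R + L) / (2 * a)⌋₊, ?_, by linarith, by linarith⟩
  rw [Nat.floor_lt hpos]
  refine lt_of_lt_of_le ?_ (Nat.le_ceil _)
  rw [div_lt_div_iff₀ (by linarith) ha]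
  nlinarith

lemma card_abs_add_sum_signOf_mul_lt_le [DecidableEq ι] (b : ι → ℝ) {a : ℝ} (ha : 0 < a)
    (hb : ∀ i, a ≤ |b i|) (R L : ℝ) :
    Finset.card {e : ι → Bool | |R + ∑ i, signOf (e i) * b i| < L} ≤
      ⌈L / a⌉₊ * (Fintype.card ι).choose (Fintype.card ι / 2) := by
  have hcover : ({e : ι → Bool | |R + ∑ i, signOf (e i) * b i| < L} : Finset _) ⊆
      (Finset.range ⌈L / a⌉₊).biUnion fun k => {e : ι → Bool |
        ∑ i, signOf (e i) * b i ∈ Ico (-R - L + 2 * a * k) (-R - L + 2 * a * k + 2 * a)} := by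
    intro e he
    simp only [Finset.mem_biUnion, Finset.mem_range, Finset.mem_filter_univ] at he ⊢
    exact exists_nat_mem_Ico_of_abs_lt ha he
  calc _ ≤ _ := Finset.card_le_card hcover
    _ ≤ _ := Finset.card_biUnion_le_card_mul _ _ _
      fun k _ => card_sum_signOf_mul_mem_Ico_le b ha hb _
    _ = _ := by rw [Finset.card_range]

lemma sq_centralBinom_mul_le (k : ℕ) : k.centralBinom ^ 2 * (2 * k + 1) ≤ 4 ^ (2 * k) := by
  induction k with
  | zero => simp
  | succ k ih =>
    refine Nat.le_of_mul_le_mul_left ?_ (show 0 < (k + 1) ^ 2 by positivity)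
    calc (k + 1) ^ 2 * ((k + 1).centralBinom ^ 2 * (2 * (k + 1) + 1))
        = ((k + 1) * (k + 1).centralBinom) ^ 2 * (2 * k + 3) := by ring
      _ = 4 * ((2 * k + 1) * (2 * k + 3)) * (k.centralBinom ^ 2 * (2 * k + 1)) := by
          rw [Nat.succ_mul_centralBinom_succ]; ring
      _ ≤ 4 * (4 * (k + 1) ^ 2) * 4 ^ (2 * k) :=
          Nat.mul_le_mul (by nlinarith) ih
      _ = (k + 1) ^ 2 * 4 ^ (2 * (k + 1)) := by ring

lemma sq_choose_half_mul_le (N : ℕ) : N.choose (N / 2) ^ 2 * (N + 1) ≤ 4 ^ N := by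
  obtain ⟨k, rfl | rfl⟩ := N.even_or_odd'
  · rw [Nat.mul_div_cancel_left _ two_pos, ← Nat.centralBinom_eq_two_mul_choose]
    exact sq_centralBinom_mul_le k
  · have hcentral : (k + 1).centralBinom = 2 * (2 * k + 1).choose k := by
      rw [Nat.centralBinom_eq_two_mul_choose, Nat.mul_succ, Nat.choose_succ_succ',
        Nat.choose_symm_half, ← two_mul]
    have h := sq_centralBinom_mul_le (k + 1)
    rw [hcentral, show 2 * (k + 1) = 2 * k + 1 + 1 by ring, pow_succ 4 (2 * k + 1)] at h
    rw [show (2 * k + 1) / 2 = k by omega]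
    nlinarith [sq_nonneg ((2 * k + 1).choose k)]

lemma choose_half_le (N : ℕ) : (N.choose (N / 2) : ℝ) ≤ 2 ^ N / √(N + 1) := by
  have h : (N.choose (N / 2) : ℝ) ^ 2 * (N + 1) ≤ 4 ^ N := by
    exact_mod_cast sq_choose_half_mul_le N
  rw [le_div_iff₀ (by positivity)]
  refine le_of_sq_le_sq ?_ (by positivity)
  rwa [mul_pow, Real.sq_sqrt (by positivity), pow_right_comm, show (2 : ℝ) ^ 2 = 4 by norm_num]

lemma card_abs_add_sum_signOf_mul_lt_le_div_sqrt [DecidableEq ι] (b : ι → ℝ) {a : ℝ} (ha : 0 < a)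
    (hb : ∀ i, a ≤ |b i|) (R : ℝ) {L : ℝ} (hL : 0 ≤ L) :
    (Finset.card {e : ι → Bool | |R + ∑ i, signOf (e i) * b i| < L} : ℝ) ≤
      (L / a + 1) / √(Fintype.card ι + 1) * 2 ^ Fintype.card ι := by
  calc (Finset.card {e : ι → Bool | |R + ∑ i, signOf (e i) * b i| < L} : ℝ)
      ≤ ⌈L / a⌉₊ * (Fintype.card ι).choose (Fintype.card ι / 2) := by
        exact_mod_cast card_abs_add_sum_signOf_mul_lt_le b ha hb R L
    _ ≤ (L / a + 1) * (2 ^ Fintype.card ι / √(Fintype.card ι + 1)) := by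
        gcongr
        · exact (Nat.ceil_lt_add_one (by positivity)).le
        · exact choose_half_le _
    _ = _ := by ring

end AntiConcentration

section Coins

variable {Ω ι κ S : Type*}

/-- The law of a fair coin. -/
def fairCoin : Measure Bool := uniformOn univ

instance isProbabilityMeasure_fairCoin : IsProbabilityMeasure fairCoin :=
  isProbabilityMeasure_uniformOn finite_univ univ_nonempty

lemma fairCoin_singleton (b : Bool) : fairCoin {b} = 2⁻¹ := by
  rw [fairCoin, uniformOn_univ]; simp

lemma map_xor_fairCoin (b : Bool) : fairCoin.map (fun a => xor a b) = fairCoin := by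
  refine Measure.ext_of_singleton fun a => ?_
  have hpreimage : (fun a => xor a b) ⁻¹' {a} = {xor a b} := by
    ext c; cases a <;> cases b <;> cases c <;> simp
  rw [Measure.map_apply (measurable_of_countable _) (measurableSet_singleton _), hpreimage,
    fairCoin_singleton, fairCoin_singleton]

/-- The law of a family of independent fair coins. -/
def coinMeasure (ι : Type*) : Measure (ι → Bool) := Measure.infinitePi fun _ => fairCoin

instance isProbabilityMeasure_coinMeasure (ι : Type*) : IsProbabilityMeasure (coinMeasure ι) :=
  inferInstanceAs (IsProbabilityMeasure (Measure.infinitePi fun _ => fairCoin))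

open scoped Classical in
/-- Flip those of the coins at the positions `q i` for which `e i` holds. -/
def flipAt (q : κ → ι) (e : κ → Bool) (ω : ι → Bool) (j : ι) : Bool :=
  xor (ω j) (decide (∃ i, q i = j ∧ e i))

lemma flipAt_apply {q : κ → ι} (hq : Function.Injective q) (e : κ → Bool) (ω : ι → Bool) (i : κ) :
    flipAt q e ω (q i) = xor (ω (q i)) (e i) := by
  simp [flipAt, hq.eq_iff]

lemma flipAt_of_notMem_range {q : κ → ι} (e : κ → Bool) (ω : ι → Bool) {j : ι}
    (hj : j ∉ range q) : flipAt q e ω j = ω j := by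
  have hflip : ¬∃ i, q i = j ∧ e i := fun ⟨i, hi, _⟩ => hj ⟨i, hi⟩
  simp [flipAt, hflip]

lemma measurePreserving_flipAt (q : κ → ι) (e : κ → Bool) :
    MeasurePreserving (flipAt q e) (coinMeasure ι) (coinMeasure ι) := by
  classical
  let flip (j : ι) (a : Bool) : Bool := xor a (decide (∃ i, q i = j ∧ e i))
  have hflip (j : ι) : Measurable (flip j) := measurable_of_countable _
  refine ⟨measurable_pi_lambda _ fun j => (hflip j).comp (measurable_pi_apply j), ?_⟩
  calc (coinMeasure ι).map (flipAt q e)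
      = Measure.infinitePi fun j => fairCoin.map (flip j) :=
        Measure.infinitePi_map_pi (fun _ => fairCoin) hflip
    _ = coinMeasure ι := by simp only [flip, map_xor_fairCoin, coinMeasure]

variable [MeasurableSpace Ω] {μ : Measure Ω} [Fintype κ] [Nonempty κ]

open scoped Classical in
lemma measure_diff_le_of_measurePreserving {f : κ → Ω → Ω}
    (hf : ∀ i, MeasurePreserving (f i) μ μ) {A B : Set Ω} (hA : MeasurableSet A)
    (hB : MeasurableSet B) (hfA : ∀ i ω, f i ω ∈ A ↔ ω ∈ A) {p : ℝ≥0∞}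
    (hp : ∀ ω ∈ A, (Finset.card {i | f i ω ∉ B} : ℝ≥0∞) ≤ p * Fintype.card κ) :
    μ (A \ B) ≤ p * μ A := by
  have hAB := hA.diff hB
  have hcount (ω : Ω) : ∑ i, (A \ B).indicator (1 : Ω → ℝ≥0∞) (f i ω) =
      A.indicator (fun ω => (Finset.card {i | f i ω ∉ B} : ℝ≥0∞)) ω := by
    by_cases hω : ω ∈ A
    · simp [indicator_apply, hfA, hω, Finset.card_filter, ite_not]
    · simp [hfA, hω]
  rw [← ENNReal.mul_le_mul_iff_right (a := Fintype.card κ) (by simp) (by simp)]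
  calc (Fintype.card κ : ℝ≥0∞) * μ (A \ B)
      = ∑ i, ∫⁻ ω, (A \ B).indicator (1 : Ω → ℝ≥0∞) (f i ω) ∂μ := by
        simp [(hf _).lintegral_comp (measurable_one.indicator hAB), lintegral_indicator_one hAB]
    _ = ∫⁻ ω, ∑ i, (A \ B).indicator (1 : Ω → ℝ≥0∞) (f i ω) ∂μ :=
        (lintegral_finsetSum _ fun i _ =>
          (measurable_one.indicator hAB).comp (hf i).measurable).symm
    _ ≤ ∫⁻ ω, A.indicator (fun _ => p * Fintype.card κ) ω ∂μ := by
        refine lintegral_mono fun ω => ?_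
        rw [hcount]
        exact indicator_le_indicator' (hp ω)
    _ = Fintype.card κ * (p * μ A) := by rw [lintegral_indicator_const hA]; ring

open scoped Classical in
/-- The transformations may depend on the point `ω` through an invariant `s ω` that takes countably
many values. -/
lemma measure_diff_le_of_adaptive_measurePreserving [Countable S] [MeasurableSpace S]
    [MeasurableSingletonClass S] {s : Ω → S} (hs : Measurable s) {f : S → κ → Ω → Ω}
    (hf : ∀ c i, MeasurePreserving (f c i) μ μ) (hfs : ∀ c i ω, s (f c i ω) = s ω)
    {A B : Set Ω} (hA : MeasurableSet A) (hB : MeasurableSet B)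
    (hfA : ∀ c i ω, f c i ω ∈ A ↔ ω ∈ A) {p : ℝ≥0∞}
    (hp : ∀ ω ∈ A, (Finset.card {i | f (s ω) i ω ∉ B} : ℝ≥0∞) ≤ p * Fintype.card κ) :
    μ (A \ B) ≤ p * μ A := by
  have hfibers (C : Set Ω) : μ C = ∑' c, μ (C ∩ s ⁻¹' {c}) := by
    have h := tsum_measure_preimage_singleton (μ := μ.restrict C) (f := s) countable_univ
      fun c _ => hs (measurableSet_singleton c)
    rw [tsum_univ fun c => μ.restrict C (s ⁻¹' {c}), preimage_univ,
      Measure.restrict_apply_univ] at h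
    simp_rw [← h, Measure.restrict_apply (hs (measurableSet_singleton _)), inter_comm]
  calc μ (A \ B) = ∑' c, μ ((A ∩ s ⁻¹' {c}) \ B) := by
        rw [hfibers]
        simp_rw [inter_sdiff_right_comm]
    _ ≤ ∑' c, p * μ (A ∩ s ⁻¹' {c}) := by
        refine ENNReal.tsum_le_tsum fun c => measure_diff_le_of_measurePreserving (hf c)
          (hA.inter (hs (measurableSet_singleton c))) hB (fun i ω => ?_) fun ω hω => ?_
        · simp [hfA, hfs]
        · obtain ⟨hωA, rfl⟩ := hω
          exact hp ω hωA
    _ = p * μ A := by rw [ENNReal.tsum_mul_left, ← hfibers A]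

end Coins

section Shears

/-- The tent function, i.e. the linear interpolation of the indicator of the integer `0`. -/
def tent (x : ℝ) : ℝ := max 0 (1 - |x|)

@[fun_prop]
lemma continuous_tent : Continuous tent := by unfold tent; fun_prop

lemma tent_of_abs_le_one {x : ℝ} (h : |x| ≤ 1) : tent x = 1 - |x| := max_eq_right (by linarith)

lemma tent_of_one_le_abs {x : ℝ} (h : 1 ≤ |x|) : tent x = 0 := max_eq_left (by linarith)

/-- Linear interpolation of a sequence indexed by the integers. -/
def interp (ε : ℤ → ℝ) (x : ℝ) : ℝ :=
  (1 - Int.fract x) * ε ⌊x⌋ + Int.fract x * ε (⌊x⌋ + 1)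

lemma interp_sub (ε ε' : ℤ → ℝ) (x : ℝ) : interp (ε - ε') x = interp ε x - interp ε' x := by
  simp only [interp, Pi.sub_apply]
  ring

lemma interp_single (k : ℤ) (c x : ℝ) : interp (Pi.single k c) x = c * tent (x - k) := by
  have hfloor := Int.floor_add_fract x
  have hfract := Int.fract_nonneg x
  have hfract' := (Int.fract_lt_one x).le
  by_cases hk : k = ⌊x⌋
  · rw [hk, show x - ⌊x⌋ = Int.fract x by linarith,
      tent_of_abs_le_one (by rwa [abs_of_nonneg hfract]), abs_of_nonneg hfract]
    simp [interp, mul_comm]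
  by_cases hk' : k = ⌊x⌋ + 1
  · have hsub : x - k = -(1 - Int.fract x) := by rw [hk']; push_cast; linarith
    have habs : |x - k| = 1 - Int.fract x := by rw [hsub, abs_neg, abs_of_nonneg (by linarith)]
    rw [tent_of_abs_le_one (by linarith), habs, hk']
    simp [interp, mul_comm]
  · have habs : 1 ≤ |x - k| := by
      rcases lt_or_gt_of_ne hk with h | h
      · have hcast : (k : ℝ) + 1 ≤ ⌊x⌋ := by exact_mod_cast h
        exact le_trans (by linarith) (le_abs_self _)
      · have hcast : (⌊x⌋ : ℝ) + 1 + 1 ≤ k := by exact_mod_cast (show ⌊x⌋ + 1 + 1 ≤ k by omega)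
        exact le_trans (by linarith) (neg_le_abs _)
    simp [tent_of_one_le_abs habs, interp, Ne.symm hk, Ne.symm hk']

lemma interp_of_mem_Icc (ε : ℤ → ℝ) {k : ℤ} {x : ℝ} (hx : x ∈ Icc (k : ℝ) (k + 1)) :
    interp ε x = ε k + (x - k) * (ε (k + 1) - ε k) := by
  rcases hx.2.eq_or_lt with h | h
  · have hfloor : ⌊x⌋ = k + 1 := by rw [h, Int.floor_add_one, Int.floor_intCast]
    have hfract : Int.fract x = 0 := by rw [Int.fract, hfloor, h]; push_cast; ring
    rw [interp, hfract, hfloor, h]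
    ring
  · rw [interp, Int.fract, Int.floor_eq_iff.2 ⟨hx.1, h⟩]
    ring

variable {ε : ℤ → ℝ} {M : ℝ}

lemma abs_interp_le (hε : ∀ k, |ε k| ≤ M) (x : ℝ) : |interp ε x| ≤ M := by
  have hfract := Int.fract_nonneg x
  have hfract' : 0 ≤ 1 - Int.fract x := sub_nonneg.2 (Int.fract_lt_one x).le
  calc |interp ε x| ≤ (1 - Int.fract x) * |ε ⌊x⌋| + Int.fract x * |ε (⌊x⌋ + 1)| := by
        refine (abs_add_le _ _).trans_eq ?_
        rw [abs_mul, abs_mul, abs_of_nonneg hfract, abs_of_nonneg hfract']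
    _ ≤ (1 - Int.fract x) * M + Int.fract x * M := by gcongr <;> apply hε
    _ = M := by ring

lemma abs_interp_sub_le_two_mul (hε : ∀ k, |ε k| ≤ M) (x y : ℝ) :
    |interp ε x - interp ε y| ≤ 2 * M := by
  linarith [abs_sub (interp ε x) (interp ε y), abs_interp_le hε x, abs_interp_le hε y]

lemma abs_interp_sub_le_of_mem_Icc (hε : ∀ k, |ε k| ≤ M) {k : ℤ} {x y : ℝ}
    (hx : x ∈ Icc (k : ℝ) (k + 1)) (hy : y ∈ Icc (k : ℝ) (k + 1)) :
    |interp ε x - interp ε y| ≤ 2 * M * |x - y| := by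
  have hslope : |ε (k + 1) - ε k| ≤ 2 * M := by
    linarith [abs_sub (ε (k + 1)) (ε k), hε k, hε (k + 1)]
  rw [interp_of_mem_Icc ε hx, interp_of_mem_Icc ε hy,
    show ε k + (x - k) * (ε (k + 1) - ε k) - (ε k + (y - k) * (ε (k + 1) - ε k)) =
      (ε (k + 1) - ε k) * (x - y) by ring, abs_mul]
  gcongr

lemma abs_interp_sub_le (hε : ∀ k, |ε k| ≤ M) (x y : ℝ) :
    |interp ε x - interp ε y| ≤ 2 * M * |x - y| := by
  wlog hyx : y ≤ x generalizing x y
  · rw [abs_sub_comm, abs_sub_comm x]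
    exact this y x (le_of_not_ge hyx)
  have hM : 0 ≤ M := (abs_nonneg _).trans (hε 0)
  have habs : |x - y| = x - y := abs_of_nonneg (sub_nonneg.2 hyx)
  rcases le_total 1 (x - y) with hfar | hnear
  · exact (abs_interp_sub_le_two_mul hε x y).trans (le_mul_of_one_le_right (by positivity)
      (hfar.trans_eq habs.symm))
  have hy : y ∈ Icc (⌊y⌋ : ℝ) (⌊y⌋ + 1) := ⟨Int.floor_le y, (Int.lt_floor_add_one y).le⟩
  rcases le_total x (⌊y⌋ + 1) with hx | hx
  · exact abs_interp_sub_le_of_mem_Icc hε ⟨hy.1.trans hyx, hx⟩ hy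
  · set p : ℝ := ((⌊y⌋ + 1 : ℤ) : ℝ) with hp
    have hpy : p = ⌊y⌋ + 1 := by rw [hp]; push_cast; rfl
    have hxp := abs_interp_sub_le_of_mem_Icc hε (k := ⌊y⌋ + 1) (x := x) (y := p)
      ⟨by linarith, by linarith [hy.2]⟩ ⟨le_rfl, by linarith⟩
    have hpy' := abs_interp_sub_le_of_mem_Icc hε (x := p) ⟨by linarith, hpy.le⟩ hy
    rw [abs_of_nonneg (show 0 ≤ x - p by linarith)] at hxp
    rw [abs_of_nonneg (show 0 ≤ p - y by linarith [hy.2])] at hpy'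
    rw [habs]
    linarith [abs_sub_le (interp ε x) (interp ε p) (interp ε y)]

lemma abs_interp_sub_le_rpow (hε : ∀ k, |ε k| ≤ M) {α : ℝ} (hα0 : 0 ≤ α) (hα1 : α ≤ 1)
    (x y : ℝ) : |interp ε x - interp ε y| ≤ 2 * M * |x - y| ^ α := by
  have hM : 0 ≤ M := (abs_nonneg _).trans (hε 0)
  rcases le_total 1 |x - y| with hfar | hnear
  · exact (abs_interp_sub_le_two_mul hε x y).trans (le_mul_of_one_le_right (by positivity)
      (Real.one_le_rpow hfar hα0))
  · refine (abs_interp_sub_le hε x y).trans ?_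
    gcongr
    exact Real.self_le_rpow_of_le_one (abs_nonneg _) hnear hα1

lemma continuous_interp (hε : ∀ k, |ε k| ≤ M) : Continuous (interp ε) := by
  have hM : 0 ≤ M := (abs_nonneg _).trans (hε 0)
  refine (LipschitzWith.of_dist_le_mul (K := ⟨2 * M, by positivity⟩) fun x y => ?_).continuous
  rw [Real.dist_eq, Real.dist_eq]
  exact abs_interp_sub_le hε x y

lemma abs_signOf_comp_le (ε : ℤ → Bool) (k : ℤ) : |(signOf ∘ ε) k| ≤ 1 := (abs_signOf _).le

lemma continuous_euclideanSpace_single {d : ℕ} (c : Fin d) :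
    Continuous fun a : ℝ => (EuclideanSpace.single c a : Space d) :=
  (PiLp.continuous_toLp 2 fun _ : Fin d => ℝ).comp (continuous_single (A := fun _ : Fin d => ℝ) c)

lemma norm_single_mul_interp_le (c : Fin 2) (A : ℝ) (ε : ℤ → Bool) (x : ℝ) :
    ‖(EuclideanSpace.single c (A * interp (signOf ∘ ε) x) : Space 2)‖ ≤ |A| := by
  rw [PiLp.norm_single, Real.norm_eq_abs, abs_mul]
  exact mul_le_of_le_one_right (abs_nonneg _) (abs_interp_le (abs_signOf_comp_le ε) x)

/-- The shear flow in direction `c` with amplitude `A`, whose profile interpolates the signs `ε` at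
scale `s`. The transverse direction is `c + 1`, with addition modulo `2`. -/
def shearField (c : Fin 2) (A s : ℝ) (ε : ℤ → Bool) : Space 2 →ᵇ Space 2 :=
  BoundedContinuousFunction.ofNormedAddCommGroup
    (fun x => EuclideanSpace.single c (A * interp (signOf ∘ ε) (x (c + 1) / s)))
    ((continuous_euclideanSpace_single c).comp
      (continuous_const.mul ((continuous_interp (abs_signOf_comp_le ε)).comp (by fun_prop))))
    |A| (fun _ => norm_single_mul_interp_le c A ε _)

lemma shearField_apply (c : Fin 2) (A s : ℝ) (ε : ℤ → Bool) (x : Space 2) :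
    shearField c A s ε x =
      EuclideanSpace.single c (A * interp (signOf ∘ ε) (x (c + 1) / s)) := rfl

lemma norm_shearField_le (c : Fin 2) (A s : ℝ) (ε : ℤ → Bool) : ‖shearField c A s ε‖ ≤ |A| :=
  BoundedContinuousFunction.norm_ofNormedAddCommGroup_le _ (abs_nonneg A) _

variable {α : ℝ≥0} {s : ℝ}

lemma dist_shearField_apply_le (c : Fin 2) (hα : α ≤ 1) (hs : 0 < s) (ε : ℤ → Bool)
    (x y : Space 2) :
    dist (shearField c (s ^ (α : ℝ) / 2) s ε x) (shearField c (s ^ (α : ℝ) / 2) s ε y) ≤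
      dist x y ^ (α : ℝ) := by
  have hcoord : |x (c + 1) - y (c + 1)| ≤ dist x y := by
    simpa [dist_eq_norm] using PiLp.norm_apply_le (x - y) (c + 1)
  have hsα : 0 < s ^ (α : ℝ) := Real.rpow_pos_of_pos hs _
  have hprofile := abs_interp_sub_le_rpow (abs_signOf_comp_le ε) α.coe_nonneg
    (NNReal.coe_le_one.2 hα) (x (c + 1) / s) (y (c + 1) / s)
  rw [← sub_div, abs_div, abs_of_pos hs, Real.div_rpow (abs_nonneg _) hs.le] at hprofile
  rw [shearField_apply, shearField_apply, dist_eq_norm, ← PiLp.single_sub,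
    PiLp.norm_single, Real.norm_eq_abs, ← mul_sub, abs_mul, abs_of_pos (half_pos hsα)]
  calc _ ≤ s ^ (α : ℝ) / 2 * (2 * 1 * (|x (c + 1) - y (c + 1)| ^ (α : ℝ) / s ^ (α : ℝ))) := by
        gcongr
    _ = |x (c + 1) - y (c + 1)| ^ (α : ℝ) := by field_simp
    _ ≤ dist x y ^ (α : ℝ) := by gcongr

lemma holderNorm_shearField_le (c : Fin 2) (hα : α ≤ 1) (hs : 0 < s) (hs1 : s ≤ 1)
    (ε : ℤ → Bool) : holderNorm α (shearField c (s ^ (α : ℝ) / 2) s ε) ≤ 2 := by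
  have hamplitude : |s ^ (α : ℝ) / 2| ≤ 1 := by
    rw [abs_of_pos (half_pos (Real.rpow_pos_of_pos hs _))]
    linarith [Real.rpow_le_one hs.le hs1 α.coe_nonneg]
  have hsup : (⨆ x, ‖shearField c (s ^ (α : ℝ) / 2) s ε x‖ₑ) ≤ 1 := by
    refine iSup_le fun x => ?_
    rw [← ofReal_norm, ← ENNReal.ofReal_one]
    exact ENNReal.ofReal_le_ofReal ((norm_single_mul_interp_le _ _ _ _).trans hamplitude)
  have hseminorm :
      (if α = 0 then 0 else eHolderNorm α (shearField c (s ^ (α : ℝ) / 2) s ε)) ≤ 1 := by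
    split_ifs
    · exact zero_le
    · refine HolderWith.eHolderNorm_le (C := 1) fun x y => ?_
      rw [edist_dist, edist_dist, ENNReal.coe_one, one_mul,
        ENNReal.ofReal_rpow_of_nonneg dist_nonneg α.coe_nonneg]
      exact ENNReal.ofReal_le_ofReal (dist_shearField_apply_le c hα hs ε x y)
  calc holderNorm α (shearField c (s ^ (α : ℝ) / 2) s ε) ≤ 1 + 1 := add_le_add hsup hseminorm
    _ = 2 := one_add_one_eq_two

end Shears

section Velocity

/-- Stage `n` is the time interval `(2⁻ⁿ⁻¹, 2⁻ⁿ]`; it ends at `stageTime n`. -/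
def stageTime (n : ℕ) : ℝ := (1 / 2) ^ n

/-- The stage containing a given time. -/
def stageOf (t : ℝ) : ℕ := Nat.log 2 ⌊t⁻¹⌋₊

/-- The direction of the shears of stage `n`; they alternate. -/
def stageDir (n : ℕ) : Fin 2 := Fin.ofNat 2 n

/-- The length scale of the shears of stage `n`. -/
def shearScale (n : ℕ) : ℝ := (1 / 2) ^ ((n + 1) ^ 2 + 1)

/-- The separation of trajectories aimed for at the end of stage `n`. -/
def gapScale (n : ℕ) : ℝ := (1 / 2) ^ (n ^ 2)

/-- Half the number of time blocks of stage `n` is `2` to this power. The term `10 * n` makes the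
blocks long enough to absorb every factor that is exponential in `n`. -/
def blockExp (α : ℝ≥0) (n : ℕ) : ℕ := ⌊2 * (1 - (α : ℝ)) * n ^ 2⌋₊ - 10 * n

/-- The number of time blocks of stage `n`. -/
def numBlocks (α : ℝ≥0) (n : ℕ) : ℕ := 2 * 2 ^ blockExp α n

/-- The length of the time blocks of stage `n`. -/
def blockLen (α : ℝ≥0) (n : ℕ) : ℝ := (1 / 2) ^ (blockExp α n + n + 2)

/-- The amplitude of the shears of stage `n`. -/
def shearAmp (α : ℝ≥0) (n : ℕ) : ℝ := shearScale n ^ (α : ℝ) / 2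

/-- The random signs are indexed by stage, time block and node of the shear profile. The time blocks
of a stage are counted from time `0`, so that those within stage `n` have the numbers
`numBlocks α n + i` with `i < numBlocks α n`. -/
abbrev SignIndex : Type := ℕ × ℕ × ℤ

/-- The sample space of the random signs. -/
abbrev SignSpace : Type := SignIndex → Bool

/-- The velocity field: alternating random shears whose scales accumulate at time `0`. -/
def velocity (α : ℝ≥0) (ω : SignSpace) (t : ℝ) : Space 2 →ᵇ Space 2 :=
  shearField (stageDir (stageOf t)) (shearAmp α (stageOf t)) (shearScale (stageOf t))
    fun k => ω (stageOf t, ⌊t / blockLen α (stageOf t)⌋₊, k)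

lemma stageTime_pos (n : ℕ) : 0 < stageTime n := by unfold stageTime; positivity

lemma stageTime_le_one (n : ℕ) : stageTime n ≤ 1 := pow_le_one₀ (by norm_num) (by norm_num)

lemma stageTime_zero : stageTime 0 = 1 := pow_zero _

lemma stageTime_succ (n : ℕ) : stageTime (n + 1) = stageTime n / 2 := by
  rw [stageTime, pow_succ, ← stageTime]; ring

lemma stageTime_antitone : Antitone stageTime := fun _ _ h =>
  pow_le_pow_of_le_one (by norm_num) (by norm_num) h

lemma tendsto_stageTime : Filter.Tendsto stageTime Filter.atTop (nhds 0) :=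
  tendsto_pow_atTop_nhds_zero_of_lt_one (by norm_num) (by norm_num)

lemma stageDir_succ (n : ℕ) : stageDir (n + 1) = stageDir n + 1 := by
  ext; simp [stageDir, Fin.val_add]

lemma shearScale_pos (n : ℕ) : 0 < shearScale n := by unfold shearScale; positivity

lemma shearScale_le_one (n : ℕ) : shearScale n ≤ 1 := pow_le_one₀ (by norm_num) (by norm_num)

lemma gapScale_pos (n : ℕ) : 0 < gapScale n := by unfold gapScale; positivity

lemma gapScale_succ (n : ℕ) : gapScale (n + 1) = 2 * shearScale n := by
  rw [gapScale, shearScale, pow_succ _ ((n + 1) ^ 2)]; ring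

lemma blockLen_pos (α : ℝ≥0) (n : ℕ) : 0 < blockLen α n := by unfold blockLen; positivity

lemma numBlocks_mul_blockLen (α : ℝ≥0) (n : ℕ) :
    numBlocks α n * blockLen α n = stageTime (n + 1) := by
  have h : (2 : ℝ) ^ blockExp α n * (1 / 2) ^ blockExp α n = 1 := by
    rw [← mul_pow, mul_one_div_cancel two_ne_zero, one_pow]
  calc (numBlocks α n * blockLen α n : ℝ)
      = 2 ^ blockExp α n * (1 / 2) ^ blockExp α n * (1 / 2) ^ (n + 1) := by
        rw [numBlocks, blockLen]; push_cast; ring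
    _ = stageTime (n + 1) := by rw [h, one_mul, stageTime]

lemma shearAmp_pos (α : ℝ≥0) (n : ℕ) : 0 < shearAmp α n :=
  half_pos (Real.rpow_pos_of_pos (shearScale_pos n) _)

lemma shearAmp_le_one (α : ℝ≥0) (n : ℕ) : shearAmp α n ≤ 1 := by
  have h := Real.rpow_le_one (shearScale_pos n).le (shearScale_le_one n) α.coe_nonneg
  rw [shearAmp]
  linarith

lemma le_stageOf {n : ℕ} {t : ℝ} (h0 : 0 < t) (h : t ≤ stageTime n) : n ≤ stageOf t := by
  refine Nat.le_log_of_pow_le one_lt_two (Nat.le_floor ?_)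
  rw [le_inv_comm₀ (by positivity) h0]
  simpa [stageTime] using h

lemma stageOf_eq {n : ℕ} {t : ℝ} (ht : t ∈ Ioc (stageTime (n + 1)) (stageTime n)) :
    stageOf t = n := by
  have h0 : 0 < t := (stageTime_pos _).trans ht.1
  refine le_antisymm (Nat.lt_succ_iff.1 (Nat.log_lt_of_lt_pow' n.succ_ne_zero ?_))
    (le_stageOf h0 ht.2)
  rw [Nat.floor_lt (by positivity), inv_lt_comm₀ h0 (by positivity)]
  simpa [stageTime] using ht.1

lemma measurable_stageOf : Measurable stageOf :=
  (measurable_of_countable (Nat.log 2)).comp (Nat.measurable_floor.comp measurable_inv)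

lemma measurable_stageOf_prodMk_blockIndex (α : ℝ≥0) :
    Measurable fun t : ℝ => (stageOf t, ⌊t / blockLen α (stageOf t)⌋₊) :=
  measurable_stageOf.prodMk (Nat.measurable_floor.comp
    (measurable_id.div ((measurable_of_countable (blockLen α)).comp measurable_stageOf)))

variable {α : ℝ≥0}

lemma norm_velocity_le (ω : SignSpace) (t : ℝ) : ‖velocity α ω t‖ ≤ 1 := by
  refine (norm_shearField_le _ _ _ _).trans ?_
  rw [abs_of_pos (shearAmp_pos _ _)]
  exact shearAmp_le_one α _

lemma holderNorm_velocity_le (hα : α ≤ 1) (ω : SignSpace) (t : ℝ) :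
    holderNorm α (velocity α ω t) ≤ 2 :=
  holderNorm_shearField_le _ hα (shearScale_pos _) (shearScale_le_one _) _

lemma measurable_interp {β : Type*} [MeasurableSpace β] {ε : β → ℤ → ℝ} {x : β → ℝ}
    (hε : ∀ k, Measurable fun b => ε b k) (hx : Measurable x) :
    Measurable fun b => interp (ε b) (x b) := by
  have heval : Measurable fun p : β × ℤ => ε p.1 p.2 := measurable_from_prod_countable_left hε
  exact ((measurable_const.sub hx.fract).mul (heval.comp (measurable_id.prodMk hx.floor))).add
    (hx.fract.mul (heval.comp (measurable_id.prodMk (hx.floor.add_const 1))))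

lemma measurable_velocity (α : ℝ≥0) :
    Measurable fun p : SignSpace × ℝ × Space 2 => velocity α p.1 p.2.1 p.2.2 := by
  have hshear : Measurable fun q : (SignSpace × Space 2) × (ℕ × ℕ) =>
      shearField (stageDir q.2.1) (shearAmp α q.2.1) (shearScale q.2.1)
        (fun k => q.1.1 (q.2.1, q.2.2, k)) q.1.2 := by
    refine measurable_from_prod_countable_left fun ⟨n, j⟩ => ?_
    have hprofile : Measurable fun p : SignSpace × Space 2 =>
        interp (signOf ∘ fun k => p.1 (n, j, k)) (p.2 (stageDir n + 1) / shearScale n) := by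
      refine measurable_interp (fun k => ?_) ?_
      · exact (measurable_of_countable signOf).comp
          ((measurable_pi_apply (n, j, k)).comp measurable_fst)
      · exact ((by fun_prop : Measurable fun x : Space 2 => x (stageDir n + 1)).comp
          measurable_snd).div_const _
    exact (continuous_euclideanSpace_single (stageDir n)).measurable.comp
      (hprofile.const_mul (shearAmp α n))
  exact hshear.comp ((measurable_fst.prodMk (measurable_snd.comp measurable_snd)).prodMk
    ((measurable_stageOf_prodMk_blockIndex α).comp (measurable_fst.comp measurable_snd)))

lemma stronglyMeasurable_velocity (α : ℝ≥0) (ω : SignSpace) :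
    StronglyMeasurable (velocity α ω) := by
  have h : StronglyMeasurable fun q : ℕ × ℕ =>
      shearField (stageDir q.1) (shearAmp α q.1) (shearScale q.1) fun k => ω (q.1, q.2, k) :=
    StronglyMeasurable.of_discrete
  exact h.comp_measurable (measurable_stageOf_prodMk_blockIndex α)

lemma isRandomVelocityField_velocity (α : ℝ≥0) (T : ℝ≥0) :
    IsRandomVelocityField T (velocity α) where
  measurable := measurable_velocity α
  memL1C0 ω := Measure.integrableOn_of_bounded (M := 1) (by simp)
    (stronglyMeasurable_velocity α ω).aestronglyMeasurable
    (Filter.Eventually.of_forall fun t => norm_velocity_le ω t)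

lemma velocity_eq_of_mem_stage (ω : SignSpace) {n : ℕ} {s : ℝ}
    (hs : s ∈ Ioc (stageTime (n + 1)) (stageTime n)) :
    velocity α ω s = shearField (stageDir n) (shearAmp α n) (shearScale n)
      fun k => ω (n, ⌊s / blockLen α n⌋₊, k) := by
  rw [velocity, stageOf_eq hs]

lemma velocity_congr {ω ω' : SignSpace} {n : ℕ} (h : ∀ q : SignIndex, n ≤ q.1 → ω q = ω' q)
    {s : ℝ} (hs0 : 0 < s) (hs : s ≤ stageTime n) : velocity α ω s = velocity α ω' s := by
  rw [velocity, velocity]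
  exact congrArg _ (funext fun k => h _ (le_stageOf hs0 hs))

end Velocity

/-! ### Picard iteration -/

section Picard

variable {d : ℕ} {T : ℝ≥0}

/-- The increment of the driving path since time `0`, extended to the real line. -/
def noise (W : Path0 d T) (s : ℝ) : Space d := IccExtend T.2 W s - W (startTime T)

lemma continuous_noise_uncurry : Continuous fun p : Path0 d T × ℝ => noise p.1 p.2 :=
  (continuous_fst.eval (continuous_projIcc.comp continuous_snd)).sub
    (continuous_fst.eval continuous_const)

lemma continuous_noise (W : Path0 d T) : Continuous (noise W) :=
  continuous_noise_uncurry.comp (Continuous.prodMk_right W)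

lemma measurable_noise : Measurable fun p : Path0 d T × ℝ => noise p.1 p.2 :=
  continuous_noise_uncurry.measurable

lemma IccExtend_path {f : Icc (0 : ℝ) T → Space d} {s : ℝ} (hs : s ∈ Icc (0 : ℝ) T) :
    IccExtend T.2 f s = f ⟨s, hs⟩ :=
  IccExtend_of_mem T.2 f hs

lemma noise_sub_noise (W : Path0 d T) (s t : Icc (0 : ℝ) T) :
    noise W s - noise W t = W s - W t := by
  rw [noise, noise, sub_sub_sub_cancel_right, IccExtend_path s.2, IccExtend_path t.2]

lemma intervalIntegrable_apply {u : ℝ → Space d →ᵇ Space d} {a b : ℝ}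
    (hu : IntervalIntegrable u volume a b) {x : ℝ → Space d} (hx : Continuous x) :
    IntervalIntegrable (fun s => u s (x s)) volume a b :=
  hu.mono_fun
    (ContinuousEval.continuous_eval.comp_aestronglyMeasurable
      (hu.def'.aestronglyMeasurable.prodMk hx.aestronglyMeasurable))
    (Filter.Eventually.of_forall fun s => (u s).norm_coe_le_norm (x s))

lemma measurable_intervalIntegral {β E : Type*} [MeasurableSpace β] [NormedAddCommGroup E]
    [NormedSpace ℝ E] [MeasurableSpace E] [BorelSpace E] {f : β → ℝ → E}
    (hf : StronglyMeasurable fun p : β × ℝ => f p.1 p.2) (a : ℝ) :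
    Measurable fun p : β × ℝ => ∫ s in a..p.2, f p.1 s := by
  have hf' : StronglyMeasurable fun q : (β × ℝ) × ℝ => f q.1.1 q.2 :=
    hf.comp_measurable (measurable_fst.fst.prodMk measurable_snd)
  have hleft : MeasurableSet {q : (β × ℝ) × ℝ | q.2 ∈ Ioc a q.1.2} :=
    (measurableSet_lt measurable_const measurable_snd).inter
      (measurableSet_le measurable_snd measurable_fst.snd)
  have hright : MeasurableSet {q : (β × ℝ) × ℝ | q.2 ∈ Ioc q.1.2 a} :=
    (measurableSet_lt measurable_fst.snd measurable_snd).inter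
      (measurableSet_le measurable_snd measurable_const)
  have h := ((hf'.indicator hleft).integral_prod_right' (ν := volume)).sub
    ((hf'.indicator hright).integral_prod_right' (ν := volume))
  refine (congrArg Measurable (funext fun p => ?_)).mp h.measurable
  rw [intervalIntegral, ← integral_indicator measurableSet_Ioc,
    ← integral_indicator measurableSet_Ioc]
  rfl

/-- Picard iterates of the equation `x' = u(t, x + w)`, `x 0 = z`. For a solution `X` driven by a
path with increments `w`, these approximate `X - w`. -/
def picard (u : ℝ → Space d →ᵇ Space d) (z : Space d) (w : ℝ → Space d) : ℕ → ℝ → Space d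
  | 0, _ => z
  | k + 1, t => z + ∫ s in (0 : ℝ)..t, u s (picard u z w k s + w s)

lemma continuous_picard {u : ℝ → Space d →ᵇ Space d}
    (hu : ∀ a b, IntervalIntegrable u volume a b) (z : Space d) {w : ℝ → Space d}
    (hw : Continuous w) (k : ℕ) : Continuous (picard u z w k) := by
  induction k with
  | zero => exact continuous_const
  | succ k ih =>
    exact continuous_const.add (intervalIntegral.continuous_primitive
      (fun a b => intervalIntegrable_apply (hu a b) (ih.add hw)) 0)

lemma measurable_picard {β : Type*} [MeasurableSpace β] {u : β → ℝ → Space d →ᵇ Space d}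
    (hu : Measurable fun p : β × ℝ × Space d => u p.1 p.2.1 p.2.2) (z : Space d)
    {w : β → ℝ → Space d} (hw : Measurable fun p : β × ℝ => w p.1 p.2) (k : ℕ) :
    Measurable fun p : β × ℝ => picard (u p.1) z (w p.1) k p.2 := by
  induction k with
  | zero => exact measurable_const
  | succ k ih =>
    let f (b : β) (s : ℝ) : Space d := u b s (picard (u b) z (w b) k s + w b s)
    have hf : Measurable fun p : β × ℝ => f p.1 p.2 :=
      hu.comp (measurable_fst.prodMk (measurable_snd.prodMk (ih.add hw)))
    exact measurable_const.add (measurable_intervalIntegral hf.stronglyMeasurable 0)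

end Picard

/-! ### Trajectories of the velocity field switched on at a positive time -/

section Trajectories

variable {α : ℝ≥0} {m n : ℕ} {z : Space 2} {ω ω' : SignSpace} {W : Path0 2 1} {s t : ℝ}

/-- The velocity field switched on at the beginning of stage `m - 1`. -/
def delayedVelocity (α : ℝ≥0) (m : ℕ) (ω : SignSpace) : ℝ → Space 2 →ᵇ Space 2 :=
  (Ioi (stageTime m)).indicator (velocity α ω)

lemma delayedVelocity_of_le (hs : s ≤ stageTime m) : delayedVelocity α m ω s = 0 :=
  indicator_of_notMem (not_lt.2 hs) _

lemma delayedVelocity_of_lt (hs : stageTime m < s) :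
    delayedVelocity α m ω s = velocity α ω s := indicator_of_mem hs _

lemma norm_delayedVelocity_le (ω : SignSpace) (s : ℝ) : ‖delayedVelocity α m ω s‖ ≤ 1 :=
  (norm_indicator_le_norm_self _ _).trans (norm_velocity_le ω s)

lemma intervalIntegrable_delayedVelocity (α : ℝ≥0) (m : ℕ) (ω : SignSpace) (a b : ℝ) :
    IntervalIntegrable (delayedVelocity α m ω) volume a b :=
  (intervalIntegrable_const (c := (1 : ℝ))).mono_fun
    ((stronglyMeasurable_velocity α ω).indicator measurableSet_Ioi).aestronglyMeasurable
    (Filter.Eventually.of_forall fun s =>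
      (norm_delayedVelocity_le ω s).trans_eq norm_one.symm)

lemma memL1C0_delayedVelocity (α : ℝ≥0) (m : ℕ) (ω : SignSpace) (T : ℝ≥0) :
    MemL1C0 T (delayedVelocity α m ω) :=
  (integrableOn_Icc_iff_integrableOn_Ioc).2 (intervalIntegrable_delayedVelocity α m ω 0 T).1

lemma measurable_delayedVelocity (α : ℝ≥0) (m : ℕ) :
    Measurable fun p : SignSpace × ℝ × Space 2 => delayedVelocity α m p.1 p.2.1 p.2.2 := by
  have hset : MeasurableSet {p : SignSpace × ℝ × Space 2 | stageTime m < p.2.1} :=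
    measurableSet_lt measurable_const measurable_snd.fst
  refine (congrArg Measurable (funext fun p => ?_)).mp ((measurable_velocity α).indicator hset)
  rcases le_or_gt p.2.1 (stageTime m) with hp | hp
  · rw [delayedVelocity_of_le hp, indicator_of_notMem (by exact not_lt.2 hp)]; rfl
  · rw [delayedVelocity_of_lt hp, indicator_of_mem (by exact hp)]

lemma delayedVelocity_congr_signs (h : ∀ q : SignIndex, n ≤ q.1 → ω q = ω' q)
    (hs : s ≤ stageTime n) : delayedVelocity α m ω s = delayedVelocity α m ω' s := by
  rcases le_or_gt s (stageTime m) with hsm | hsm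
  · rw [delayedVelocity_of_le hsm, delayedVelocity_of_le hsm]
  · rw [delayedVelocity_of_lt hsm, delayedVelocity_of_lt hsm,
      velocity_congr h ((stageTime_pos m).trans hsm) hs]

lemma delayedVelocity_apply_transverse (hs : s ∈ Ioc (stageTime (n + 1)) (stageTime n))
    (x : Space 2) : delayedVelocity α m ω s x (stageDir n + 1) = 0 := by
  rcases le_or_gt s (stageTime m) with hsm | hsm
  · rw [delayedVelocity_of_le hsm]; rfl
  · rw [delayedVelocity_of_lt hsm, velocity_eq_of_mem_stage ω hs, shearField_apply]
    simp

lemma delayedVelocity_congr_transverse (hs : s ∈ Ioc (stageTime (n + 1)) (stageTime n))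
    {x x' : Space 2} (h : x (stageDir n + 1) = x' (stageDir n + 1)) :
    delayedVelocity α m ω s x = delayedVelocity α m ω s x' := by
  rcases le_or_gt s (stageTime m) with hsm | hsm
  · rw [delayedVelocity_of_le hsm]; rfl
  · rw [delayedVelocity_of_lt hsm, velocity_eq_of_mem_stage ω hs, shearField_apply,
      shearField_apply, h]

lemma picard_delayedVelocity_of_le (w : ℝ → Space 2) (k : ℕ) (ht : t ≤ stageTime m) :
    picard (delayedVelocity α m ω) z w k t = z := by
  cases k with
  | zero => rfl
  | succ k =>
    rw [picard, intervalIntegral.integral_zero_ae, add_zero]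
    refine Filter.Eventually.of_forall fun s hs => ?_
    rw [delayedVelocity_of_le (hs.2.trans (max_le (stageTime_pos m).le ht))]
    rfl

lemma picard_succ_sub_picard_succ {w : ℝ → Space 2} (hw : Continuous w) (k : ℕ) (a b : ℝ)
    (c : Fin 2) :
    picard (delayedVelocity α m ω) z w (k + 1) b c -
        picard (delayedVelocity α m ω) z w (k + 1) a c =
      ∫ s in a..b, delayedVelocity α m ω s (picard (delayedVelocity α m ω) z w k s + w s) c := by
  have hu := intervalIntegrable_delayedVelocity α m ω
  have hint (a b : ℝ) : IntervalIntegrable (fun s => delayedVelocity α m ω s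
      (picard (delayedVelocity α m ω) z w k s + w s)) volume a b :=
    intervalIntegrable_apply (hu a b) ((continuous_picard hu z hw k).add hw)
  rw [← PiLp.sub_apply, picard, picard, add_sub_add_left_eq_sub,
    intervalIntegral.integral_interval_sub_left (hint 0 b) (hint 0 a)]
  exact ((EuclideanSpace.proj c : Space 2 →L[ℝ] ℝ).intervalIntegral_comp_comm (hint a b)).symm

lemma picard_transverse {w : ℝ → Space 2} (hw : Continuous w) (k : ℕ)
    (hs : s ∈ Icc (stageTime (n + 1)) (stageTime n)) :
    picard (delayedVelocity α m ω) z w k s (stageDir n + 1) =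
      picard (delayedVelocity α m ω) z w k (stageTime (n + 1)) (stageDir n + 1) := by
  cases k with
  | zero => rfl
  | succ k =>
    rw [← sub_eq_zero, picard_succ_sub_picard_succ hw]
    refine intervalIntegral.integral_zero_ae (Filter.Eventually.of_forall fun r hr => ?_)
    rw [uIoc_of_le hs.1] at hr
    exact delayedVelocity_apply_transverse ⟨hr.1, hr.2.trans hs.2⟩ _

/-- Each Picard iteration is exact for one more stage: during a stage the drift depends only on the
coordinate that does not move. -/
lemma picard_succ_eq {w : ℝ → Space 2} (hw : Continuous w) (k : ℕ) :
    ∀ {n : ℕ}, m ≤ n + k → ∀ {t : ℝ}, t ≤ stageTime n →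
      picard (delayedVelocity α m ω) z w (k + 1) t = picard (delayedVelocity α m ω) z w k t := by
  induction k with
  | zero =>
    intro n hn t ht
    have htm := ht.trans (stageTime_antitone hn)
    rw [picard_delayedVelocity_of_le w 1 htm, picard_delayedVelocity_of_le w 0 htm]
  | succ k ih =>
    intro n hn t ht
    rw [picard, picard]
    refine congrArg (z + ·) (intervalIntegral.integral_congr_ae
      (Filter.Eventually.of_forall fun s hs => ?_))
    have hst : s ≤ stageTime n := hs.2.trans (max_le (stageTime_pos n).le ht)
    rcases le_or_gt s (stageTime (n + 1)) with hsn | hsn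
    · rw [ih (n := n + 1) (by omega) hsn]
    · refine delayedVelocity_congr_transverse ⟨hsn, hst⟩ ?_
      rw [PiLp.add_apply, PiLp.add_apply, picard_transverse hw _ ⟨hsn.le, hst⟩,
        picard_transverse hw _ ⟨hsn.le, hst⟩, ih (n := n + 1) (by omega) le_rfl]

lemma picard_congr_signs (h : ∀ q : SignIndex, n ≤ q.1 → ω q = ω' q) (w : ℝ → Space 2) (k : ℕ)
    (ht : t ≤ stageTime n) :
    picard (delayedVelocity α m ω) z w k t = picard (delayedVelocity α m ω') z w k t := by
  induction k generalizing t with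
  | zero => rfl
  | succ k ih =>
    rw [picard, picard]
    refine congrArg (z + ·) (intervalIntegral.integral_congr_ae
      (Filter.Eventually.of_forall fun s hs => ?_))
    have hst : s ≤ stageTime n := hs.2.trans (max_le (stageTime_pos n).le ht)
    rw [ih hst, delayedVelocity_congr_signs h hst]

/-- The solution started at `z`, with the velocity field switched on at the beginning of stage
`m - 1`, in the frame moving with the noise. The Picard iteration is exact after `m` steps. -/
def trajectory (α : ℝ≥0) (m : ℕ) (z : Space 2) (ω : SignSpace) (W : Path0 2 1) : ℝ → Space 2 :=
  picard (delayedVelocity α m ω) z (noise W) m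

lemma continuous_trajectory (α : ℝ≥0) (m : ℕ) (z : Space 2) (ω : SignSpace) (W : Path0 2 1) :
    Continuous (trajectory α m z ω W) :=
  continuous_picard (intervalIntegrable_delayedVelocity α m ω) z (continuous_noise W) m

lemma measurable_trajectory (α : ℝ≥0) (m : ℕ) (z : Space 2) :
    Measurable fun p : (SignSpace × Path0 2 1) × ℝ => trajectory α m z p.1.1 p.1.2 p.2 := by
  have hu : Measurable fun p : (SignSpace × Path0 2 1) × ℝ × Space 2 =>
      delayedVelocity α m p.1.1 p.2.1 p.2.2 := by
    have hproj : Measurable fun p : (SignSpace × Path0 2 1) × ℝ × Space 2 => (p.1.1, p.2) :=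
      measurable_fst.fst.prodMk measurable_snd
    exact ((measurable_delayedVelocity α m).comp hproj :)
  have hw : Measurable fun p : (SignSpace × Path0 2 1) × ℝ => noise p.1.2 p.2 :=
    measurable_noise.comp (measurable_fst.snd.prodMk measurable_snd)
  exact measurable_picard (u := fun b : SignSpace × Path0 2 1 => delayedVelocity α m b.1)
    (w := fun b => noise b.2) hu z hw m

lemma trajectory_of_le (ht : t ≤ stageTime m) : trajectory α m z ω W t = z :=
  picard_delayedVelocity_of_le _ m ht

lemma trajectory_congr_signs (h : ∀ q : SignIndex, n ≤ q.1 → ω q = ω' q) (ht : t ≤ stageTime n) :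
    trajectory α m z ω W t = trajectory α m z ω' W t :=
  picard_congr_signs h _ m ht

lemma trajectory_transverse (hs : s ∈ Icc (stageTime (n + 1)) (stageTime n)) :
    trajectory α m z ω W s (stageDir n + 1) =
      trajectory α m z ω W (stageTime (n + 1)) (stageDir n + 1) :=
  picard_transverse (continuous_noise W) m hs

lemma trajectory_sub_trajectory (hs : s ≤ 1) (ht : t ≤ 1) (c : Fin 2) :
    trajectory α m z ω W t c - trajectory α m z ω W s c =
      ∫ r in s..t, delayedVelocity α m ω r (trajectory α m z ω W r + noise W r) c := by
  have hexact {r : ℝ} (hr : r ≤ 1) := picard_succ_eq (α := α) (z := z) (ω := ω)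
    (continuous_noise W) m (n := 0) m.zero_add.ge (hr.trans_eq stageTime_zero.symm)
  rw [trajectory, ← hexact hs, ← hexact ht, picard_succ_sub_picard_succ (continuous_noise W)]

lemma trajectory_eq (ht : t ≤ 1) :
    trajectory α m z ω W t =
      z + ∫ s in (0 : ℝ)..t, delayedVelocity α m ω s (trajectory α m z ω W s + noise W s) := by
  rw [trajectory, ← picard_succ_eq (continuous_noise W) m (n := 0) (by omega)
    (ht.trans_eq stageTime_zero.symm), picard]

/-- The solution of the equation driven by `W`, with the velocity field switched on at the beginning
of stage `m - 1`. -/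
def delayedSolution (α : ℝ≥0) (m : ℕ) (z : Space 2) (ω : SignSpace) (W : Path0 2 1) : Path0 2 1 :=
  ⟨fun t => trajectory α m z ω W t + noise W t,
    ((continuous_trajectory α m z ω W).add (continuous_noise W)).comp continuous_subtype_val⟩

lemma isCaratheodorySolution_delayedSolution (α : ℝ≥0) (m : ℕ) (z : Space 2) (ω : SignSpace)
    (W : Path0 2 1) :
    IsCaratheodorySolution (delayedVelocity α m ω) z W (delayedSolution α m z ω W) := by
  intro t
  have hdrift : ∫ s in (0 : ℝ)..t, delayedVelocity α m ω s
      (trajectory α m z ω W s + noise W s) = ∫ s in (0 : ℝ)..t, delayedVelocity α m ω s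
      (IccExtend (1 : ℝ≥0).2 (delayedSolution α m z ω W) s) := by
    refine intervalIntegral.integral_congr fun s hs => ?_
    rw [uIcc_of_le t.2.1] at hs
    exact congrArg _ (IccExtend_path (f := delayedSolution α m z ω W)
      ⟨hs.1, hs.2.trans t.2.2⟩).symm
  have hnoise : noise W t = W t - W (startTime 1) := congrArg (· - _) (IccExtend_path t.2)
  rw [← hdrift, add_sub_assoc, ← hnoise, ← trajectory_eq (t.2.2.trans_eq NNReal.coe_one)]
  rfl

/-- The beginning of the `i`-th time block of stage `n`. -/
def blockStart (α : ℝ≥0) (n i : ℕ) : ℝ := (numBlocks α n + i) * blockLen α n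

lemma blockStart_zero (α : ℝ≥0) (n : ℕ) : blockStart α n 0 = stageTime (n + 1) := by
  rw [← numBlocks_mul_blockLen α, blockStart, Nat.cast_zero, add_zero]

lemma blockStart_numBlocks (α : ℝ≥0) (n : ℕ) :
    blockStart α n (numBlocks α n) = stageTime n := by
  rw [blockStart, add_mul, numBlocks_mul_blockLen, stageTime_succ, add_halves]

lemma blockStart_succ (α : ℝ≥0) (n i : ℕ) :
    blockStart α n (i + 1) = blockStart α n i + blockLen α n := by
  rw [blockStart, blockStart]; push_cast; ring

lemma blockStart_mono (α : ℝ≥0) (n : ℕ) : Monotone (blockStart α n) :=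
  monotone_nat_of_le_succ fun i => by
    rw [blockStart_succ]; exact le_add_of_nonneg_right (blockLen_pos α n).le

lemma block_subset {i : ℕ} (hi : i < numBlocks α n) :
    Icc (blockStart α n i) (blockStart α n (i + 1)) ⊆ Icc (stageTime (n + 1)) (stageTime n) := by
  rw [← blockStart_zero α n, ← blockStart_numBlocks α n]
  exact Icc_subset_Icc (blockStart_mono α n (Nat.zero_le _)) (blockStart_mono α n hi)

lemma blockIndex_eq {i : ℕ} (hs : s ∈ Ico (blockStart α n i) (blockStart α n (i + 1))) :
    ⌊s / blockLen α n⌋₊ = numBlocks α n + i := by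
  have h0 := blockLen_pos α n
  have hstart : 0 ≤ blockStart α n i := by unfold blockStart; positivity
  rw [Nat.floor_eq_iff (div_nonneg (hstart.trans hs.1) h0.le), le_div_iff₀ h0, div_lt_iff₀ h0]
  simpa [blockStart, add_assoc] using hs

/-- The displacement produced during the `i`-th time block of stage `n` when the transverse
coordinate is `x`, up to the amplitude. -/
def blockIntegral (α : ℝ≥0) (ω : SignSpace) (W : Path0 2 1) (n i : ℕ) (x : ℝ) : ℝ :=
  ∫ s in blockStart α n i..blockStart α n (i + 1),
    interp (signOf ∘ fun k => ω (n, numBlocks α n + i, k))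
      ((x + noise W s (stageDir n + 1)) / shearScale n)

lemma delayedVelocity_apply_dir_of_mem_block (hn : n < m) {i : ℕ} (hi : i < numBlocks α n)
    (hs : s ∈ Ioo (blockStart α n i) (blockStart α n (i + 1))) (x : Space 2) :
    delayedVelocity α m ω s x (stageDir n) = shearAmp α n *
      interp (signOf ∘ fun k => ω (n, numBlocks α n + i, k))
        (x (stageDir n + 1) / shearScale n) := by
  have hsub := block_subset hi
  have hstart := (hsub ⟨le_rfl, hs.1.le.trans hs.2.le⟩).1
  have hstage : s ∈ Ioc (stageTime (n + 1)) (stageTime n) :=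
    ⟨hstart.trans_lt hs.1, (hsub (Ioo_subset_Icc_self hs)).2⟩
  rw [delayedVelocity_of_lt ((stageTime_antitone hn).trans_lt hstage.1),
    velocity_eq_of_mem_stage ω hstage, shearField_apply, blockIndex_eq (Ioo_subset_Ico_self hs)]
  simp

lemma intervalIntegrable_drift_along_trajectory (α : ℝ≥0) (m : ℕ) (z : Space 2) (ω : SignSpace)
    (W : Path0 2 1) (a b : ℝ) : IntervalIntegrable (fun s => delayedVelocity α m ω s
      (trajectory α m z ω W s + noise W s)) volume a b :=
  intervalIntegrable_apply (intervalIntegrable_delayedVelocity α m ω a b)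
    ((continuous_trajectory α m z ω W).add (continuous_noise W))

lemma trajectory_dir (hn : n < m) :
    trajectory α m z ω W (stageTime n) (stageDir n) =
      trajectory α m z ω W (stageTime (n + 1)) (stageDir n) +
      ∑ i ∈ Finset.range (numBlocks α n), shearAmp α n * blockIntegral α ω W n i
        (trajectory α m z ω W (stageTime (n + 1)) (stageDir n + 1)) := by
  have hint (a b : ℝ) : IntervalIntegrable (fun s => delayedVelocity α m ω s
      (trajectory α m z ω W s + noise W s) (stageDir n)) volume a b :=
    let proj : Space 2 →L[ℝ] ℝ := EuclideanSpace.proj (stageDir n)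
    have h := intervalIntegrable_drift_along_trajectory α m z ω W a b
    ⟨proj.integrable_comp h.1, proj.integrable_comp h.2⟩
  rw [← sub_eq_iff_eq_add', trajectory_sub_trajectory (stageTime_le_one _) (stageTime_le_one _),
    ← blockStart_zero α n, ← blockStart_numBlocks α n,
    ← intervalIntegral.sum_integral_adjacent_intervals fun i _ => hint _ _]
  refine Finset.sum_congr rfl fun i hi => ?_
  have hile := blockStart_mono α n (Nat.le_succ i)
  rw [blockIntegral, ← intervalIntegral.integral_const_mul, intervalIntegral.integral_of_le hile,
    intervalIntegral.integral_of_le hile, integral_Ioc_eq_integral_Ioo,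
    integral_Ioc_eq_integral_Ioo]
  refine setIntegral_congr_fun measurableSet_Ioo fun s hs => ?_
  have hi' := Finset.mem_range.1 hi
  simp only [delayedVelocity_apply_dir_of_mem_block hn hi' hs, PiLp.add_apply,
    trajectory_transverse (block_subset hi' (Ioo_subset_Icc_self hs)), blockStart_zero]

end Trajectories

/-! ### Limits of Carathéodory solutions -/

section Limits

open Filter Topology

variable {d : ℕ} {T ε : ℝ≥0} {u : ℝ → Space d →ᵇ Space d} {y : Space d} {W X : Path0 d T}
  {g : ℝ → ℝ}

lemma isCaratheodorySolution_restrictPath (h : ε ≤ T) (hX : IsCaratheodorySolution u y W X) :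
    IsCaratheodorySolution u y (restrictPath h W) (restrictPath h X) := by
  intro t
  have hdrift : ∫ s in (0 : ℝ)..t, u s (IccExtend ε.2 (restrictPath h X) s) =
      ∫ s in (0 : ℝ)..t, u s (IccExtend T.2 X s) := by
    refine intervalIntegral.integral_congr fun s hs => ?_
    rw [uIcc_of_le t.2.1] at hs
    have hsε : s ∈ Icc (0 : ℝ) ε := ⟨hs.1, hs.2.trans t.2.2⟩
    simp only [IccExtend_path hsε, IccExtend_path (Icc_subset_Icc_right (by exact_mod_cast h) hsε)]
    rfl
  rw [hdrift]
  exact hX (inclusion (Icc_subset_Icc_right (NNReal.coe_le_coe.mpr h)) t)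

lemma MemL1C0.intervalIntegrable (hu : MemL1C0 T u) (s t : Icc (0 : ℝ) T) :
    IntervalIntegrable u volume s t :=
  (hu.mono_set (uIcc_subset_Icc s.2 t.2)).intervalIntegrable

lemma IsCaratheodorySolution.sub_eq (hX : IsCaratheodorySolution u y W X) (hu : MemL1C0 T u)
    (s t : Icc (0 : ℝ) T) :
    X t - X s = (∫ r in (s : ℝ)..t, u r (IccExtend T.2 X r)) + (W t - W s) := by
  have hint (r : Icc (0 : ℝ) T) := intervalIntegrable_apply
    (hu.intervalIntegrable (startTime T) r) (X.continuous.Icc_extend' (h := T.2))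
  rw [hX t, hX s, ← intervalIntegral.integral_interval_sub_left (hint t) (hint s)]
  simp only [startTime]
  abel

lemma IsCaratheodorySolution.dist_le (hX : IsCaratheodorySolution u y W X) (hu : MemL1C0 T u)
    (hg : ∀ a b, IntervalIntegrable g volume a b) (hug : ∀ r, ‖u r‖ ≤ g r)
    (s t : Icc (0 : ℝ) T) :
    dist (X s) (X t) ≤ |∫ r in (s : ℝ)..t, g r| + dist (W s) (W t) := by
  rw [dist_comm, dist_comm (W s), dist_eq_norm, dist_eq_norm, hX.sub_eq hu]
  refine (norm_add_le _ _).trans (add_le_add_left ?_ _)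
  exact intervalIntegral.norm_integral_le_abs_of_norm_le
    (Eventually.of_forall fun r => ((u r).norm_coe_le_norm _).trans (hug r)) (hg s t)

lemma IsCaratheodorySolution.apply_startTime (hX : IsCaratheodorySolution u y W X) :
    X (startTime T) = y := by
  have h := hX (startTime T)
  have h0 : ((startTime T : Icc (0 : ℝ) T) : ℝ) = 0 := rfl
  rwa [h0, intervalIntegral.integral_same, add_zero, add_sub_cancel_right] at h

lemma exists_tendsto_subseq_of_equicontinuous {β γ : Type*} [TopologicalSpace β] [CompactSpace β]
    [MetricSpace γ] {X : ℕ → C(β, γ)} {K : Set γ} (hK : IsCompact K) (hXK : ∀ j t, X j t ∈ K)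
    (hX : Equicontinuous fun j t => X j t) :
    ∃ (f : C(β, γ)) (φ : ℕ → ℕ), StrictMono φ ∧ Tendsto (X ∘ φ) atTop (𝓝 f) := by
  let e := ContinuousMap.isometryEquivBoundedOfCompact β γ
  have hcompact : IsCompact (closure (range (e ∘ X))) := by
    refine BoundedContinuousFunction.arzela_ascoli K hK _ ?_ ?_
    · rintro _ t ⟨j, rfl⟩
      exact hXK j t
    · have hpre (f : range (e ∘ X)) : ⇑(X f.2.choose) = f.1 := congrArg (⇑) f.2.choose_spec
      exact (congrArg Equicontinuous (funext hpre)).mp (hX.comp fun f : range (e ∘ X) => f.2.choose)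
  obtain ⟨f, -, φ, hφ, hf⟩ := hcompact.tendsto_subseq
    fun j => subset_closure (mem_range_self (f := e ∘ X) j)
  refine ⟨e.symm f, φ, hφ, ?_⟩
  have h := (e.symm.continuous.tendsto f).comp hf
  simpa [Function.comp_def] using h

variable {v : ℕ → ℝ → Space d →ᵇ Space d} {z : ℕ → Space d} {Y : ℕ → Path0 d T}

lemma equicontinuous_of_isCaratheodorySolution
    (hY : ∀ j, IsCaratheodorySolution (v j) (z j) W (Y j)) (hv : ∀ j, MemL1C0 T (v j))
    (hg : ∀ a b, IntervalIntegrable g volume a b) (hvg : ∀ j r, ‖v j r‖ ≤ g r) :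
    Equicontinuous fun j t => Y j t := fun s => by
  have hcont : Continuous fun t : Icc (0 : ℝ) T => |∫ r in (s : ℝ)..t, g r| + dist (W s) (W t) :=
    ((intervalIntegral.continuous_primitive hg s).comp continuous_subtype_val).abs.add
      (continuous_const.dist W.continuous)
  refine Metric.equicontinuousAt_of_continuity_modulus _ ?_ _
    (Eventually.of_forall fun t j => (hY j).dist_le (hv j) hg (hvg j) s t)
  simpa using hcont.tendsto s

lemma exists_isCompact_of_isCaratheodorySolution
    (hY : ∀ j, IsCaratheodorySolution (v j) (z j) W (Y j)) (hv : ∀ j, MemL1C0 T (v j))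
    (hg : ∀ a b, IntervalIntegrable g volume a b) (hvg : ∀ j r, ‖v j r‖ ≤ g r)
    (hz : Tendsto z atTop (𝓝 y)) : ∃ K, IsCompact K ∧ ∀ j t, Y j t ∈ K := by
  obtain ⟨R, hR⟩ := (Metric.isBounded_range_of_tendsto z hz).subset_closedBall y
  have hcont : Continuous fun t : Icc (0 : ℝ) T =>
      |∫ r in (startTime T : ℝ)..t, g r| + dist (W (startTime T)) (W t) :=
    ((intervalIntegral.continuous_primitive hg _).comp continuous_subtype_val).abs.add
      (continuous_const.dist W.continuous)
  obtain ⟨C, hC⟩ := (isCompact_range hcont).bddAbove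
  refine ⟨Metric.closedBall y (C + R), isCompact_closedBall y _, fun j t => ?_⟩
  have hstart : dist (Y j (startTime T)) y ≤ R :=
    (hY j).apply_startTime ▸ hR (mem_range_self j)
  have hmove : dist (Y j t) (Y j (startTime T)) ≤ C := by
    rw [dist_comm]
    exact ((hY j).dist_le (hv j) hg (hvg j) _ t).trans (hC (mem_range_self t))
  exact (dist_triangle _ _ _).trans (add_le_add hmove hstart)

lemma isCaratheodorySolution_of_tendsto
    (hY : ∀ j, IsCaratheodorySolution (v j) (z j) W (Y j)) (hv : ∀ j, MemL1C0 T (v j))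
    (hg : ∀ a b, IntervalIntegrable g volume a b) (hvg : ∀ j r, ‖v j r‖ ≤ g r)
    (hz : Tendsto z atTop (𝓝 y)) (hvu : ∀ r > 0, Tendsto (fun j => v j r) atTop (𝓝 (u r)))
    (hX : Tendsto Y atTop (𝓝 X)) : IsCaratheodorySolution u y W X := by
  intro t
  have hpath (r : ℝ) : Tendsto (fun j => IccExtend T.2 (Y j) r) atTop (𝓝 (IccExtend T.2 X r)) :=
    ((continuous_eval_const (F := Path0 d T) (projIcc 0 (T : ℝ) T.2 r)).tendsto X).comp hX
  have hdrift : Tendsto (fun j => ∫ r in (0 : ℝ)..t, v j r (IccExtend T.2 (Y j) r)) atTop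
      (𝓝 (∫ r in (0 : ℝ)..t, u r (IccExtend T.2 X r))) := by
    refine intervalIntegral.tendsto_integral_filter_of_dominated_convergence g
      (Eventually.of_forall fun j => ?_) (Eventually.of_forall fun j => ?_) (hg 0 t) ?_
    · exact (intervalIntegrable_apply ((hv j).intervalIntegrable (startTime T) t)
        (Y j).continuous.Icc_extend').def'.aestronglyMeasurable
    · exact Eventually.of_forall fun r _ => ((v j r).norm_coe_le_norm _).trans (hvg j r)
    · refine Eventually.of_forall fun r hr => ?_
      rw [uIoc_of_le t.2.1] at hr
      exact (ContinuousEval.continuous_eval.tendsto (u r, IccExtend T.2 X r)).comp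
        ((hvu r hr.1).prodMk_nhds (hpath r))
  refine tendsto_nhds_unique (((continuous_eval_const t).tendsto X).comp hX) ?_
  refine Tendsto.congr (fun j => (hY j t).symm) ?_
  exact ((hz.add hdrift).add_const _).sub_const _

theorem exists_tendsto_isCaratheodorySolution
    (hY : ∀ j, IsCaratheodorySolution (v j) (z j) W (Y j)) (hv : ∀ j, MemL1C0 T (v j))
    (hg : ∀ a b, IntervalIntegrable g volume a b) (hvg : ∀ j r, ‖v j r‖ ≤ g r)
    (hz : Tendsto z atTop (𝓝 y)) (hvu : ∀ r > 0, Tendsto (fun j => v j r) atTop (𝓝 (u r))) :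
    ∃ (X : Path0 d T) (φ : ℕ → ℕ), StrictMono φ ∧ Tendsto (Y ∘ φ) atTop (𝓝 X) ∧
      IsCaratheodorySolution u y W X := by
  obtain ⟨K, hK, hYK⟩ := exists_isCompact_of_isCaratheodorySolution hY hv hg hvg hz
  obtain ⟨X, φ, hφ, hX⟩ := exists_tendsto_subseq_of_equicontinuous hK hYK
    (equicontinuous_of_isCaratheodorySolution hY hv hg hvg)
  exact ⟨X, φ, hφ, hX, isCaratheodorySolution_of_tendsto (fun j => hY (φ j)) (fun j => hv (φ j)) hg
    (fun j => hvg (φ j)) (hz.comp hφ.tendsto_atTop)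
    (fun r hr => (hvu r hr).comp hφ.tendsto_atTop) hX⟩

end Limits

/-! ### Separated trajectories -/

section Separated

open Filter Topology

variable {α : ℝ≥0} {m n : ℕ} {y : Space 2} {ω : SignSpace} {W : Path0 2 1}

/-- The starting point of the second trajectory, at distance `gapScale m` from `y`. -/
def offsetStart (y : Space 2) (m : ℕ) : Space 2 :=
  y + EuclideanSpace.single (stageDir m) (gapScale m)

lemma dist_offsetStart (y : Space 2) (m : ℕ) : dist (offsetStart y m) y = gapScale m := by
  rw [offsetStart, dist_self_add_left, PiLp.norm_single, Real.norm_of_nonneg (gapScale_pos m).le]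

lemma gapScale_le_stageTime (n : ℕ) : gapScale n ≤ stageTime n :=
  pow_le_pow_of_le_one (by norm_num) (by norm_num) (Nat.le_self_pow two_ne_zero n)

lemma tendsto_offsetStart (y : Space 2) : Tendsto (offsetStart y) atTop (𝓝 y) := by
  rw [tendsto_iff_dist_tendsto_zero]
  simp only [dist_offsetStart]
  exact squeeze_zero (fun n => (gapScale_pos n).le) gapScale_le_stageTime tendsto_stageTime

/-- The difference at the end of stage `n`, in the direction of its shears, between the trajectories
started at `y` and at `offsetStart y m`. -/
def separation (α : ℝ≥0) (y : Space 2) (m n : ℕ) (ω : SignSpace) (W : Path0 2 1) : ℝ :=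
  trajectory α m y ω W (stageTime n) (stageDir n) -
    trajectory α m (offsetStart y m) ω W (stageTime n) (stageDir n)

/-- The two trajectories are well separated at the end of stage `n`. -/
def Separated (α : ℝ≥0) (y : Space 2) (m n : ℕ) (ω : SignSpace) (W : Path0 2 1) : Prop :=
  gapScale n ≤ |separation α y m n ω W|

lemma tendsto_delayedVelocity {ψ : ℕ → ℕ} (hψ : Tendsto ψ atTop atTop) {s : ℝ} (hs : 0 < s) :
    Tendsto (fun j => delayedVelocity α (ψ j) ω s) atTop (𝓝 (velocity α ω s)) := by
  refine tendsto_const_nhds.congr' ?_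
  filter_upwards [(tendsto_stageTime.comp hψ).eventually_lt_const hs] with j hj
  exact (delayedVelocity_of_lt hj).symm

lemma exists_tendsto_delayedSolution (α : ℝ≥0) (ω : SignSpace) (W : Path0 2 1) {ψ : ℕ → ℕ}
    (hψ : Tendsto ψ atTop atTop) {z : ℕ → Space 2} (hz : Tendsto z atTop (𝓝 y)) :
    ∃ (X : Path0 2 1) (φ : ℕ → ℕ), StrictMono φ ∧
      Tendsto (fun j => delayedSolution α (ψ (φ j)) (z (φ j)) ω W) atTop (𝓝 X) ∧
      IsCaratheodorySolution (velocity α ω) y W X :=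
  exists_tendsto_isCaratheodorySolution (g := fun _ => 1)
    (fun j => isCaratheodorySolution_delayedSolution α (ψ j) (z j) ω W)
    (fun j => memL1C0_delayedVelocity α (ψ j) ω 1)
    (fun _ _ => intervalIntegrable_const) (fun _ => norm_delayedVelocity_le ω) hz
    fun _ => tendsto_delayedVelocity hψ

lemma delayedSolution_sub_apply (α : ℝ≥0) (y : Space 2) (m n : ℕ) (ω : SignSpace) (W : Path0 2 1)
    (h : stageTime n ∈ Icc (0 : ℝ) (1 : ℝ≥0)) :
    delayedSolution α m y ω W ⟨stageTime n, h⟩ (stageDir n) -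
      delayedSolution α m (offsetStart y m) ω W ⟨stageTime n, h⟩ (stageDir n) =
      separation α y m n ω W :=
  add_sub_add_right_eq_sub _ _ _

/-- Separation at the end of stage `n` is uniform in `m`, hence passes to the limit `m → ∞`. -/
lemma exists_isCaratheodorySolution_ne (h : ∃ᶠ m in atTop, Separated α y m n ω W) :
    ∃ X₁ X₂ : Path0 2 1, IsCaratheodorySolution (velocity α ω) y W X₁ ∧
      IsCaratheodorySolution (velocity α ω) y W X₂ ∧
      ∀ t : Icc (0 : ℝ) (1 : ℝ≥0), (t : ℝ) = stageTime n → X₁ t ≠ X₂ t := by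
  obtain ⟨ψ, hψ, hsep⟩ := extraction_of_frequently_atTop h
  obtain ⟨X₁, φ₁, hφ₁, hlim₁, hX₁⟩ := exists_tendsto_delayedSolution α ω W hψ.tendsto_atTop
    (tendsto_const_nhds (x := y))
  have hψ₁ := (hψ.comp hφ₁).tendsto_atTop
  obtain ⟨X₂, φ₂, hφ₂, hlim₂, hX₂⟩ := exists_tendsto_delayedSolution α ω W hψ₁
    ((tendsto_offsetStart y).comp hψ₁)
  refine ⟨X₁, X₂, hX₁, hX₂, ?_⟩
  rintro ⟨_, ht⟩ rfl heq
  have hcoord : Continuous fun X : Path0 2 1 => X ⟨stageTime n, ht⟩ (stageDir n) := by fun_prop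
  have hlim := (((hcoord.tendsto X₁).comp (hlim₁.comp hφ₂.tendsto_atTop)).sub
    ((hcoord.tendsto X₂).comp hlim₂)).abs
  have hgap : gapScale n ≤ |X₁ ⟨stageTime n, ht⟩ (stageDir n) -
      X₂ ⟨stageTime n, ht⟩ (stageDir n)| :=
    ge_of_tendsto' hlim fun j => (hsep (φ₁ (φ₂ j))).trans_eq
      (congrArg abs (delayedSolution_sub_apply α y _ n ω W ht).symm)
  rw [heq, sub_self, abs_zero] at hgap
  exact (gapScale_pos n).not_ge hgap

lemma hasNonuniqueSolutions_of_frequently_separated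
    (h : ∃ᶠ n in atTop, ∃ᶠ m in atTop, Separated α y m n ω W) {ε : ℝ≥0} (hε : ε ≤ 1)
    (hε0 : 0 < ε) : HasNonuniqueSolutions (velocity α ω) y (restrictPath hε W) := by
  obtain ⟨n, hn, hnε⟩ := (h.and_eventually
    (tendsto_stageTime.eventually_le_const (NNReal.coe_pos.2 hε0))).exists
  obtain ⟨X₁, X₂, hX₁, hX₂, hne⟩ := exists_isCaratheodorySolution_ne hn
  refine ⟨_, _, isCaratheodorySolution_restrictPath hε hX₁,
    isCaratheodorySolution_restrictPath hε hX₂, fun heq => ?_⟩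
  let t : Icc (0 : ℝ) ε := ⟨stageTime n, (stageTime_pos n).le, hnε⟩
  exact hne (inclusion (Icc_subset_Icc_right (NNReal.coe_le_coe.mpr hε)) t) rfl
    (DFunLike.congr_fun heq t)

end Separated

/-! ### Resampling the signs at the nearest nodes -/

section Resampling

lemma le_tent_sub_tent {p q : ℝ} (d : ℝ) (hp : |p| ≤ 1 / 2) (hpq : 2 ≤ |q - p|) :
    1 / 2 - 2 * |d| ≤ tent (p + d) - tent (q + d) := by
  have hnear : |p + d| ≤ 1 / 2 + |d| := (abs_add_le _ _).trans (add_le_add_left hp _)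
  have hfar : 3 / 2 - |d| ≤ |q + d| := by
    have h := abs_sub (q + d) (p + d)
    rw [add_sub_add_right_eq_sub] at h
    linarith
  have htent_near : 1 - |p + d| ≤ tent (p + d) := le_max_right _ _
  have htent_far : tent (q + d) ≤ |d| := max_le (abs_nonneg _) (by linarith)
  linarith

lemma le_integral_tent_sub_integral_tent {w : ℝ → ℝ} (hw : Continuous w) {a b l : ℝ} (hab : a ≤ b)
    (hl : 0 < l) {x x' : ℝ} {k : ℤ} (hx : |(x + w a) / l - k| ≤ 1 / 2)
    (hxx' : 2 * l ≤ |x - x'|) :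
    (b - a) / 2 - 2 / l * ∫ s in a..b, |w s - w a| ≤
      (∫ s in a..b, tent ((x + w s) / l - k)) - ∫ s in a..b, tent ((x' + w s) / l - k) := by
  have hfar : 2 ≤ |((x' + w a) / l - k) - ((x + w a) / l - k)| := by
    rw [sub_sub_sub_cancel_right, ← sub_div, add_sub_add_right_eq_sub, abs_div, abs_of_pos hl,
      le_div_iff₀ hl, abs_sub_comm]
    exact hxx'
  have htent (z : ℝ) : Continuous fun s => tent ((z + w s) / l - k) := by fun_prop
  have hpointwise (s : ℝ) : 1 / 2 - 2 / l * |w s - w a| ≤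
      tent ((x + w s) / l - k) - tent ((x' + w s) / l - k) := by
    have h := le_tent_sub_tent ((w s - w a) / l) hx hfar
    have hshift (z : ℝ) : (z + w a) / l - k + (w s - w a) / l = (z + w s) / l - k := by ring
    rwa [hshift, hshift, abs_div, abs_of_pos hl, mul_div_left_comm,
      mul_comm |_|] at h
  have hosc : Continuous fun s => 2 / l * |w s - w a| := by fun_prop
  calc (b - a) / 2 - 2 / l * ∫ s in a..b, |w s - w a|
      = ∫ s in a..b, (1 / 2 - 2 / l * |w s - w a|) := by
        rw [intervalIntegral.integral_sub intervalIntegrable_const (hosc.intervalIntegrable _ _),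
          intervalIntegral.integral_const, intervalIntegral.integral_const_mul, smul_eq_mul]
        ring
    _ ≤ ∫ s in a..b, (tent ((x + w s) / l - k) - tent ((x' + w s) / l - k)) :=
        intervalIntegral.integral_mono_on hab ((continuous_const.sub hosc).intervalIntegrable _ _)
          (((htent x).sub (htent x')).intervalIntegrable _ _) fun s _ => hpointwise s
    _ = _ := intervalIntegral.integral_sub ((htent x).intervalIntegrable _ _)
        ((htent x').intervalIntegrable _ _)

variable {α : ℝ≥0} {m n : ℕ} {y z : Space 2} {ω ω' : SignSpace} {W : Path0 2 1}

/-- The total oscillation during the `i`-th time block of stage `n` of the component of the driving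
path transverse to the shears. -/
def blockOscillation (α : ℝ≥0) (W : Path0 2 1) (n i : ℕ) : ℝ :=
  ∫ s in blockStart α n i..blockStart α n (i + 1),
    |noise W s (stageDir n + 1) - noise W (blockStart α n i) (stageDir n + 1)|

/-- On average, the driving path moves by much less than the length scale of stage `n` during each
of the time blocks of that stage. -/
def RegularAt (α : ℝ≥0) (n : ℕ) (W : Path0 2 1) : Prop :=
  ∀ i < numBlocks α n, blockOscillation α W n i ≤ blockLen α n * shearScale n / 8

/-- The node of the shear profile that is nearest to a trajectory with transverse coordinate `x` at
the beginning of the `i`-th time block of stage `n`. -/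
def nearestNode (α : ℝ≥0) (W : Path0 2 1) (n i : ℕ) (x : ℝ) : ℤ :=
  round ((x + noise W (blockStart α n i) (stageDir n + 1)) / shearScale n)

/-- The time, weighted by proximity, that a trajectory with transverse coordinate `x` spends near
the node `k` during the `i`-th time block of stage `n`. -/
def nodeTime (α : ℝ≥0) (W : Path0 2 1) (n i : ℕ) (k : ℤ) (x : ℝ) : ℝ :=
  ∫ s in blockStart α n i..blockStart α n (i + 1),
    tent ((x + noise W s (stageDir n + 1)) / shearScale n - k)

lemma continuous_noise_apply (W : Path0 2 1) (c : Fin 2) : Continuous fun s => noise W s c :=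
  (EuclideanSpace.proj c : Space 2 →L[ℝ] ℝ).continuous.comp (continuous_noise W)

lemma le_nodeTime_sub_nodeTime {i : ℕ} (hi : i < numBlocks α n) (hW : RegularAt α n W) {x x' : ℝ}
    (hxx' : gapScale (n + 1) ≤ |x - x'|) :
    blockLen α n / 4 ≤ nodeTime α W n i (nearestNode α W n i x) x -
      nodeTime α W n i (nearestNode α W n i x) x' := by
  have hs := shearScale_pos n
  rw [gapScale_succ] at hxx'
  have h := le_integral_tent_sub_integral_tent (continuous_noise_apply W (stageDir n + 1))
    (blockStart_mono α n (Nat.le_succ i)) hs (abs_sub_round _) hxx'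
  rw [blockStart_succ, add_sub_cancel_left, ← blockStart_succ] at h
  have hosc : 2 / shearScale n * blockOscillation α W n i ≤ blockLen α n / 4 := by
    calc 2 / shearScale n * blockOscillation α W n i
        ≤ 2 / shearScale n * (blockLen α n * shearScale n / 8) := by gcongr; exact hW i hi
      _ = blockLen α n / 4 := by field
  refine le_trans ?_ h
  rw [blockOscillation] at hosc
  linarith

lemma blockIntegral_sub_blockIntegral {i : ℕ} {k : ℤ}
    (h : ∀ k' ≠ k, ω' (n, numBlocks α n + i, k') = ω (n, numBlocks α n + i, k')) (x : ℝ) :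
    blockIntegral α ω' W n i x - blockIntegral α ω W n i x =
      (signOf (ω' (n, numBlocks α n + i, k)) - signOf (ω (n, numBlocks α n + i, k))) *
        nodeTime α W n i k x := by
  have hint (σ : SignSpace) : IntervalIntegrable (fun s =>
      interp (signOf ∘ fun k => σ (n, numBlocks α n + i, k))
        ((x + noise W s (stageDir n + 1)) / shearScale n)) volume
      (blockStart α n i) (blockStart α n (i + 1)) :=
    ((continuous_interp (abs_signOf_comp_le _)).comp ((continuous_const.add
      (continuous_noise_apply W _)).div_const _)).intervalIntegrable _ _
  have hsigns : (signOf ∘ fun k => ω' (n, numBlocks α n + i, k)) -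
      (signOf ∘ fun k => ω (n, numBlocks α n + i, k)) = Pi.single k
        (signOf (ω' (n, numBlocks α n + i, k)) - signOf (ω (n, numBlocks α n + i, k))) := by
    ext k'
    rcases eq_or_ne k' k with rfl | hk
    · simp
    · simp [h k' hk, hk]
  rw [blockIntegral, blockIntegral, nodeTime, ← intervalIntegral.integral_sub (hint _) (hint _),
    ← intervalIntegral.integral_const_mul]
  refine intervalIntegral.integral_congr fun s _ => ?_
  simp only [← interp_sub, hsigns, interp_single]

/-- The index of the sign attached to the node `k i` in the `i`-th time block of stage `n`. -/
def nodeIndex (α : ℝ≥0) (n : ℕ) (k : Fin (numBlocks α n) → ℤ) (i : Fin (numBlocks α n)) :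
    SignIndex := (n, numBlocks α n + i, k i)

lemma nodeIndex_injective (k : Fin (numBlocks α n) → ℤ) : Function.Injective (nodeIndex α n k) :=
  fun _ _ h => Fin.ext (Nat.add_left_cancel (congrArg (fun q : SignIndex => q.2.1) h))

lemma trajectory_flipAt (k : Fin (numBlocks α n) → ℤ) (e : Fin (numBlocks α n) → Bool) :
    trajectory α m z (flipAt (nodeIndex α n k) e ω) W (stageTime (n + 1)) =
      trajectory α m z ω W (stageTime (n + 1)) := by
  refine trajectory_congr_signs (n := n + 1) (fun q hq => flipAt_of_notMem_range e ω ?_) le_rfl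
  rintro ⟨i, rfl⟩
  exact n.lt_irrefl hq

lemma blockIntegral_flipAt_sub (k : Fin (numBlocks α n) → ℤ) (e : Fin (numBlocks α n) → Bool)
    (i : Fin (numBlocks α n)) (x : ℝ) :
    blockIntegral α (flipAt (nodeIndex α n k) e ω) W n i x - blockIntegral α ω W n i x =
      -(signOf (e i) + 1) * signOf (ω (nodeIndex α n k i)) * nodeTime α W n i (k i) x := by
  have hflip : flipAt (nodeIndex α n k) e ω (n, numBlocks α n + i, k i) =
      xor (ω (nodeIndex α n k i)) (e i) := flipAt_apply (nodeIndex_injective k) e ω i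
  rw [blockIntegral_sub_blockIntegral (k := k i) fun k' hk' => ?_, hflip, signOf_xor, nodeIndex]
  · ring
  · refine flipAt_of_notMem_range e ω ?_
    rintro ⟨j, hj⟩
    obtain rfl : j = i :=
      Fin.ext (Nat.add_left_cancel (congrArg (fun q : SignIndex => q.2.1) hj))
    exact hk' (congrArg (fun q : SignIndex => q.2.2) hj).symm

lemma separation_eq (hn : n < m) : separation α y m n ω W =
    trajectory α m y ω W (stageTime (n + 1)) (stageDir n) -
      trajectory α m (offsetStart y m) ω W (stageTime (n + 1)) (stageDir n) +
    ∑ i : Fin (numBlocks α n), shearAmp α n *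
      (blockIntegral α ω W n i (trajectory α m y ω W (stageTime (n + 1)) (stageDir n + 1)) -
        blockIntegral α ω W n i
          (trajectory α m (offsetStart y m) ω W (stageTime (n + 1)) (stageDir n + 1))) := by
  rw [separation, trajectory_dir hn, trajectory_dir hn, add_sub_add_comm, Finset.sum_range,
    Finset.sum_range, ← Finset.sum_sub_distrib]
  simp only [mul_sub]

/-- The nodes nearest to the first trajectory in the time blocks of stage `n`. -/
def nodes (α : ℝ≥0) (y : Space 2) (m n : ℕ) (W : Path0 2 1) (ω : SignSpace)
    (i : Fin (numBlocks α n)) : ℤ :=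
  nearestNode α W n i (trajectory α m y ω W (stageTime (n + 1)) (stageDir n + 1))

/-- Flipping the signs at the nearest nodes makes the separation a sum of independent terms, each of
them large because the second trajectory stays away from these nodes. -/
lemma exists_separation_flipAt_eq (hn : n < m) (hW : RegularAt α n W)
    (hsep : Separated α y m (n + 1) ω W) :
    ∃ (R : ℝ) (b : Fin (numBlocks α n) → ℝ), (∀ i, shearAmp α n * blockLen α n / 4 ≤ |b i|) ∧
      ∀ e, separation α y m n (flipAt (nodeIndex α n (nodes α y m n W ω)) e ω) W =
        R + ∑ i, signOf (e i) * b i := by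
  set k := nodes α y m n W ω with hk
  set x := trajectory α m y ω W (stageTime (n + 1)) (stageDir n + 1) with hx
  set x' := trajectory α m (offsetStart y m) ω W (stageTime (n + 1)) (stageDir n + 1) with hx'
  let b (i : Fin (numBlocks α n)) : ℝ := -(shearAmp α n * signOf (ω (nodeIndex α n k i)) *
    (nodeTime α W n i (k i) x - nodeTime α W n i (k i) x'))
  have hxx' : gapScale (n + 1) ≤ |x - x'| := by
    rwa [Separated, separation, stageDir_succ] at hsep
  refine ⟨separation α y m n ω W + ∑ i, b i, b, fun i => ?_, fun e => ?_⟩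
  · rw [abs_neg, abs_mul, abs_mul, abs_signOf, mul_one, abs_of_pos (shearAmp_pos α n),
      mul_div_assoc]
    exact mul_le_mul_of_nonneg_left ((le_nodeTime_sub_nodeTime i.2 hW hxx').trans (le_abs_self _))
      (shearAmp_pos α n).le
  · rw [add_assoc, ← sub_eq_iff_eq_add', separation_eq hn, separation_eq hn, trajectory_flipAt,
      trajectory_flipAt, ← hx, ← hx', add_sub_add_left_eq_sub, ← Finset.sum_sub_distrib,
      ← Finset.sum_add_distrib]
    refine Finset.sum_congr rfl fun i _ => ?_
    rw [← mul_sub, sub_sub_sub_comm, blockIntegral_flipAt_sub, blockIntegral_flipAt_sub]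
    ring

/-- An upper bound for the probability that the separation is lost during stage `n`. -/
def lossBound (α : ℝ≥0) (n : ℕ) : ℝ :=
  (gapScale n / (shearAmp α n * blockLen α n / 4) + 1) / √(numBlocks α n + 1)

open scoped Classical in
lemma card_flips_not_separated_le (hn : n < m) (hW : RegularAt α n W)
    (hsep : Separated α y m (n + 1) ω W) :
    (Finset.card {e | ¬Separated α y m n (flipAt (nodeIndex α n (nodes α y m n W ω)) e ω) W} : ℝ) ≤
      lossBound α n * 2 ^ numBlocks α n := by
  obtain ⟨R, b, hb, hflip⟩ := exists_separation_flipAt_eq hn hW hsep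
  have ha : 0 < shearAmp α n * blockLen α n / 4 := by
    have := shearAmp_pos α n
    have := blockLen_pos α n
    positivity
  have h := card_abs_add_sum_signOf_mul_lt_le_div_sqrt b ha hb R (gapScale_pos n).le
  simpa only [Separated, hflip, not_le, lossBound, Fintype.card_fin] using h

lemma measurable_trajectory_apply (α : ℝ≥0) (m : ℕ) (z : Space 2) (t : ℝ) (c : Fin 2) :
    Measurable fun p : SignSpace × Path0 2 1 => trajectory α m z p.1 p.2 t c := by
  have h : Measurable fun p : SignSpace × Path0 2 1 => trajectory α m z p.1 p.2 t :=
    ((measurable_trajectory α m z).comp (measurable_id.prodMk measurable_const) :)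
  exact (EuclideanSpace.proj c : Space 2 →L[ℝ] ℝ).measurable.comp h

lemma measurableSet_separated (α : ℝ≥0) (y : Space 2) (m n : ℕ) :
    MeasurableSet {p : SignSpace × Path0 2 1 | Separated α y m n p.1 p.2} := by
  have hsep : Measurable fun p : SignSpace × Path0 2 1 => separation α y m n p.1 p.2 :=
    (measurable_trajectory_apply α m y _ _).sub
      (measurable_trajectory_apply α m (offsetStart y m) _ _)
  exact measurableSet_le measurable_const hsep.abs

lemma measurable_nodes (α : ℝ≥0) (y : Space 2) (m n : ℕ) (W : Path0 2 1) :
    Measurable (nodes α y m n W) := by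
  refine measurable_pi_lambda _ fun i => ?_
  have h : Measurable fun ω => trajectory α m y ω W (stageTime (n + 1)) (stageDir n + 1) :=
    ((measurable_trajectory_apply α m y _ _).comp measurable_prodMk_right :)
  simp only [nodes, nearestNode, round_eq]
  exact (((h.add_const _).div_const _).add_const _).floor

lemma measure_separated_diff_separated_le (hn : n < m) (hW : RegularAt α n W) (y : Space 2) :
    coinMeasure SignIndex ({ω | Separated α y m (n + 1) ω W} \ {ω | Separated α y m n ω W}) ≤
      ENNReal.ofReal (lossBound α n) := by
  classical
  have hmeas (n : ℕ) : MeasurableSet {ω | Separated α y m n ω W} :=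
    measurable_prodMk_right (measurableSet_separated α y m n)
  have : Nonempty (Fin (numBlocks α n) → Bool) := ⟨fun _ => false⟩
  refine (measure_diff_le_of_adaptive_measurePreserving (measurable_nodes α y m n W)
    (f := fun k => flipAt (nodeIndex α n k)) (fun k e => measurePreserving_flipAt _ e)
    (fun k e ω => ?_) (hmeas (n + 1)) (hmeas n) (fun k e ω => ?_) fun ω hω => ?_).trans
    (mul_le_of_le_one_right' prob_le_one)
  · simp only [nodes, trajectory_flipAt, funext_iff, implies_true]
  · simp only [Separated, separation, trajectory_flipAt, mem_ofPred_eq]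
  · have h := ENNReal.ofReal_le_ofReal (card_flips_not_separated_le hn hW hω)
    rw [ENNReal.ofReal_natCast, ENNReal.ofReal_mul' (by positivity)] at h
    simpa using h

end Resampling

/-! ### Asymptotics of the parameters -/

section Asymptotics

open Filter Topology

variable {α : ℝ≥0} {n : ℕ}

lemma half_pow_eq_rpow (k : ℕ) : (1 / 2 : ℝ) ^ k = (2 : ℝ) ^ (-(k : ℝ)) := by
  rw [Real.rpow_neg zero_le_two, Real.rpow_natCast, one_div, inv_pow]

lemma shearScale_eq_rpow (n : ℕ) : shearScale n = (2 : ℝ) ^ (-((n + 1 : ℝ) ^ 2 + 1)) := by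
  rw [shearScale, half_pow_eq_rpow]; push_cast; rfl

lemma gapScale_eq_rpow (n : ℕ) : gapScale n = (2 : ℝ) ^ (-(n : ℝ) ^ 2) := by
  rw [gapScale, half_pow_eq_rpow]; push_cast; rfl

lemma blockLen_eq_rpow (α : ℝ≥0) (n : ℕ) :
    blockLen α n = (2 : ℝ) ^ (-(blockExp α n + n + 2 : ℝ)) := by
  rw [blockLen, half_pow_eq_rpow]; push_cast; rfl

lemma numBlocks_eq_rpow (α : ℝ≥0) (n : ℕ) :
    (numBlocks α n : ℝ) = (2 : ℝ) ^ (blockExp α n + 1 : ℝ) := by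
  rw [numBlocks, ← pow_succ', ← Nat.cast_succ, Real.rpow_natCast]; push_cast; rfl

lemma shearAmp_eq_rpow (α : ℝ≥0) (n : ℕ) :
    shearAmp α n = (2 : ℝ) ^ (-((n + 1 : ℝ) ^ 2 + 1) * α - 1) := by
  rw [shearAmp, shearScale_eq_rpow, ← Real.rpow_mul zero_le_two, Real.rpow_sub_one two_ne_zero]

lemma le_blockExp (α : ℝ≥0) (n : ℕ) : 2 * (1 - α : ℝ) * n ^ 2 - 10 * n - 1 ≤ blockExp α n := by
  have hfloor := Nat.lt_floor_add_one (2 * (1 - α : ℝ) * n ^ 2)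
  have hsub : (⌊2 * (1 - α : ℝ) * n ^ 2⌋₊ : ℝ) ≤ blockExp α n + 10 * n := by
    rw [blockExp]
    exact_mod_cast le_tsub_add
  linarith

lemma blockExp_le (hα : (α : ℝ) ≤ 1 / 2) (hn : 10 ≤ n) :
    (blockExp α n : ℝ) ≤ 2 * (1 - α) * n ^ 2 - 10 * n := by
  have hn' : (10 : ℝ) ≤ n := by exact_mod_cast hn
  have hpos : (10 * n : ℝ) ≤ 2 * (1 - α) * n ^ 2 := by
    nlinarith [mul_nonneg (by linarith : (0 : ℝ) ≤ 1 - 2 * α) (sq_nonneg (n : ℝ))]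
  have hfloor := Nat.floor_le ((by positivity : (0 : ℝ) ≤ 10 * n).trans hpos)
  rw [blockExp, Nat.cast_sub (Nat.le_floor (by exact_mod_cast hpos))]
  push_cast
  linarith

lemma lossBound_le (hα : (α : ℝ) ≤ 1 / 2) (hn : 13 ≤ n) : lossBound α n ≤ 2 * (1 / 2) ^ n := by
  have hn' : (13 : ℝ) ≤ n := by exact_mod_cast hn
  have hK := blockExp_le hα (by omega : 10 ≤ n)
  have hK' := le_blockExp α n
  have hαn : α * (n : ℝ) ≤ 1 / 2 * n := by gcongr
  set B : ℝ := 2 ^ ((blockExp α n + 1 : ℝ) / 2) with hB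
  have hsqrt : B ≤ √(numBlocks α n + 1) := by
    refine le_trans (le_of_eq ?_) (Real.sqrt_le_sqrt (le_add_of_nonneg_right zero_le_one))
    rw [hB, numBlocks_eq_rpow, Real.sqrt_eq_rpow, ← Real.rpow_mul zero_le_two, mul_one_div]
  have hstep : shearAmp α n * blockLen α n / 4 =
      (2 : ℝ) ^ (-((n + 1 : ℝ) ^ 2 + 1) * α - 1 - (blockExp α n + n + 2) - 2) := by
    rw [shearAmp_eq_rpow, blockLen_eq_rpow, ← Real.rpow_add two_pos, Real.rpow_sub two_pos _ 2,
      ← sub_eq_add_neg]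
    norm_num
  have hgap : gapScale n / (shearAmp α n * blockLen α n / 4) / B ≤ (1 / 2) ^ n := by
    rw [hstep, gapScale_eq_rpow, ← Real.rpow_sub two_pos, ← Real.rpow_sub two_pos, half_pow_eq_rpow]
    refine Real.rpow_le_rpow_of_exponent_le one_le_two ?_
    linarith
  have hone : 1 / B ≤ (1 / 2) ^ n := by
    rw [one_div, ← Real.rpow_neg zero_le_two, half_pow_eq_rpow]
    refine Real.rpow_le_rpow_of_exponent_le one_le_two ?_
    nlinarith [mul_nonneg (by linarith : (0 : ℝ) ≤ 1 - 2 * α) (sq_nonneg (n : ℝ))]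
  have hnum : 0 ≤ gapScale n / (shearAmp α n * blockLen α n / 4) + 1 := by
    have := gapScale_pos n
    have := shearAmp_pos α n
    have := blockLen_pos α n
    positivity
  calc lossBound α n ≤ (gapScale n / (shearAmp α n * blockLen α n / 4) + 1) / B :=
        div_le_div_of_nonneg_left hnum (by positivity) hsqrt
    _ ≤ 2 * (1 / 2) ^ n := by rw [add_div]; linarith

lemma tsum_lossBound_ne_top (hα : (α : ℝ) ≤ 1 / 2) : ∑' n, ENNReal.ofReal (lossBound α n) ≠ ∞ := by
  have hpos (n : ℕ) : 0 ≤ lossBound α n := by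
    have := gapScale_pos n
    have := shearAmp_pos α n
    have := blockLen_pos α n
    unfold lossBound
    positivity
  have hsum : Summable (lossBound α) := by
    refine Summable.of_norm_bounded_eventually_nat (summable_geometric_two.mul_left 2) ?_
    filter_upwards [eventually_ge_atTop 13] with n hn
    rw [Real.norm_of_nonneg (hpos n)]
    exact lossBound_le hα hn
  rw [← ENNReal.ofReal_tsum_of_nonneg hpos hsum]
  exact ENNReal.ofReal_ne_top

lemma eventually_mul_le_mul_sq (c : ℝ) {η : ℝ} (hη : 0 < η) :
    ∀ᶠ n : ℕ in atTop, c * n ≤ η * (n : ℝ) ^ 2 := by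
  filter_upwards [tendsto_natCast_atTop_atTop.eventually (eventually_ge_atTop (c / η))] with n hn
  rw [div_le_iff₀ hη] at hn
  nlinarith [(Nat.cast_nonneg n : (0 : ℝ) ≤ n)]

variable {H : ℝ}

lemma blockLen_rpow_div_shearScale_le (α : ℝ≥0) (hH0 : 0 ≤ H) (hH1 : H ≤ 1) (n : ℕ) :
    blockLen α n ^ H / shearScale n ≤
      (2 : ℝ) ^ (11 * n + 2 - (2 * (1 - α) * H - 1) * (n : ℝ) ^ 2) := by
  have hK : H * (2 * (1 - α) * n ^ 2 - 9 * n) ≤ H * (blockExp α n + n + 2) := by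
    gcongr
    linarith [le_blockExp α n]
  have hHn : H * n ≤ n := mul_le_of_le_one_left n.cast_nonneg hH1
  rw [blockLen_eq_rpow, shearScale_eq_rpow, ← Real.rpow_mul zero_le_two, ← Real.rpow_sub two_pos]
  refine Real.rpow_le_rpow_of_exponent_le one_le_two ?_
  linarith

/-- A path of regularity `H` oscillates by at most a multiple of `blockLen α n ^ H` during a time
block of stage `n`, which is negligible compared with the length scale of the shears. -/
lemma eventually_mul_blockLen_rpow_le (hH0 : 0 ≤ H) (hH1 : H ≤ 1) (hH : 1 < 2 * (1 - α) * H)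
    (C : ℝ) : ∀ᶠ n in atTop, C * blockLen α n ^ H ≤ shearScale n / 8 := by
  obtain ⟨k, hk⟩ := pow_unbounded_of_one_lt (8 * C) one_lt_two
  filter_upwards [eventually_mul_le_mul_sq (k + 13 : ℝ) (sub_pos.2 hH), eventually_ge_atTop 1]
    with n hn hn1
  have hn1' : (1 : ℝ) ≤ n := by exact_mod_cast hn1
  have hkn : (k : ℝ) ≤ k * n := le_mul_of_one_le_right k.cast_nonneg hn1'
  have hratio : blockLen α n ^ H / shearScale n ≤ (2 : ℝ) ^ (-(k : ℝ)) :=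
    (blockLen_rpow_div_shearScale_le α hH0 hH1 n).trans
      (Real.rpow_le_rpow_of_exponent_le one_le_two (by linarith))
  rw [div_le_iff₀ (shearScale_pos n), Real.rpow_neg zero_le_two, Real.rpow_natCast,
    ← div_eq_inv_mul, le_div_iff₀ (by positivity)] at hratio
  have hpow : 0 ≤ blockLen α n ^ H := Real.rpow_nonneg (blockLen_pos α n).le _
  linarith [mul_le_mul_of_nonneg_left hk.le hpow]

lemma exists_summable_numBlocks_mul (hH0 : 0 ≤ H) (hH1 : H ≤ 1) (hH : 1 < 2 * (1 - α) * H) :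
    ∃ q : ℕ, Summable fun n => numBlocks α n * (8 * (blockLen α n ^ H / shearScale n)) ^ q := by
  set η := 2 * (1 - α) * H - 1
  obtain ⟨q, hq⟩ := exists_nat_ge (3 / η)
  rw [div_le_iff₀ (sub_pos.2 hH)] at hq
  have hratio (n : ℕ) : 0 ≤ blockLen α n ^ H / shearScale n :=
    div_nonneg (Real.rpow_nonneg (blockLen_pos α n).le _) (shearScale_pos n).le
  refine ⟨q, Summable.of_norm_bounded_eventually_nat summable_geometric_two ?_⟩
  filter_upwards [eventually_mul_le_mul_sq (17 * q + 2) one_pos, eventually_ge_atTop 10]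
    with n hn hn10
  have hn' : (10 : ℝ) ≤ n := by exact_mod_cast hn10
  rw [Real.norm_of_nonneg (by have := hratio n; positivity)]
  calc numBlocks α n * (8 * (blockLen α n ^ H / shearScale n)) ^ q
      ≤ (2 : ℝ) ^ (blockExp α n + 1 : ℝ) *
          ((2 : ℝ) ^ (3 : ℝ) * (2 : ℝ) ^ (11 * n + 2 - η * (n : ℝ) ^ 2)) ^ (q : ℝ) := by
        rw [numBlocks_eq_rpow, Real.rpow_natCast]
        gcongr
        · exact mul_nonneg (by norm_num) (hratio n)
        · exact hratio n
        · norm_num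
        · exact blockLen_rpow_div_shearScale_le α hH0 hH1 n
    _ = (2 : ℝ) ^ (blockExp α n + 1 + (3 + (11 * n + 2 - η * (n : ℝ) ^ 2)) * q) := by
        rw [← Real.rpow_add two_pos, ← Real.rpow_mul zero_le_two, ← Real.rpow_add two_pos]
    _ ≤ (2 : ℝ) ^ (-(n : ℝ)) := Real.rpow_le_rpow_of_exponent_le one_le_two ?_
    _ = (1 / 2) ^ n := (half_pow_eq_rpow n).symm
  have hα : (α : ℝ) ≤ 1 / 2 := by
    by_contra! h
    nlinarith
  have hK := blockExp_le hα hn10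
  have hαn : 0 ≤ α * (n : ℝ) ^ 2 := by positivity
  have hqn : (q : ℝ) * 10 ≤ q * n := by gcongr
  have hηn : 3 * (n : ℝ) ^ 2 ≤ q * η * (n : ℝ) ^ 2 := by gcongr
  linarith

end Asymptotics

/-! ### Separation at infinitely many stages -/

section FrequentlySeparated

open Filter Topology

variable {α : ℝ≥0} {m n : ℕ} {y : Space 2} {W : Path0 2 1}

lemma separated_self (α : ℝ≥0) (y : Space 2) (m : ℕ) (ω : SignSpace) (W : Path0 2 1) :
    Separated α y m m ω W := by
  rw [Separated, separation, trajectory_of_le le_rfl, trajectory_of_le le_rfl, offsetStart]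
  simp [abs_of_pos (gapScale_pos m)]

lemma measure_not_separated_le (hreg : ∀ k ≥ n, RegularAt α k W) (y : Space 2) (hnm : n ≤ m) :
    coinMeasure SignIndex {ω | ¬Separated α y m n ω W} ≤
      ∑' k, ENNReal.ofReal (lossBound α (k + n)) := by
  have hsub : {ω | ¬Separated α y m n ω W} ⊆ ⋃ k ∈ Finset.range (m - n),
      {ω | Separated α y m (k + n + 1) ω W} \ {ω | Separated α y m (k + n) ω W} := by
    intro ω hω
    by_contra hkept
    refine hω (Nat.decreasingInduction' (fun k hkm hnk hsep => ?_) hnm (separated_self α y m ω W))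
    by_contra hlost
    refine hkept (mem_iUnion₂.2 ⟨k - n, Finset.mem_range.2 (by omega), ?_⟩)
    rw [Nat.sub_add_cancel hnk]
    exact ⟨hsep, hlost⟩
  calc coinMeasure SignIndex {ω | ¬Separated α y m n ω W}
      ≤ ∑ k ∈ Finset.range (m - n), coinMeasure SignIndex
          ({ω | Separated α y m (k + n + 1) ω W} \ {ω | Separated α y m (k + n) ω W}) :=
        (measure_mono hsub).trans (measure_biUnion_finset_le _ _)
    _ ≤ ∑ k ∈ Finset.range (m - n), ENNReal.ofReal (lossBound α (k + n)) :=
        Finset.sum_le_sum fun k hk => measure_separated_diff_separated_le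
          (by have := Finset.mem_range.1 hk; omega) (hreg _ (Nat.le_add_left n k)) y
    _ ≤ _ := ENNReal.sum_le_tsum _

lemma measure_eventually_mem_le {β : Type*} [MeasurableSpace β] {μ : Measure β} {s : ℕ → Set β}
    {c : ℝ≥0∞} (h : ∀ᶠ n in atTop, μ (s n) ≤ c) : μ {x | ∀ᶠ n in atTop, x ∈ s n} ≤ c := by
  have hunion : {x | ∀ᶠ n in atTop, x ∈ s n} = ⋃ N, ⋂ n ≥ N, s n := by
    ext x
    simp only [mem_ofPred_eq, eventually_atTop, mem_iUnion, mem_iInter]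
  have hmono : Monotone fun N => ⋂ n ≥ N, s n := fun N N' hN =>
    biInter_mono (fun n hn => hN.trans hn) fun _ _ => Subset.rfl
  rw [hunion, hmono.measure_iUnion]
  refine iSup_le fun N => ?_
  obtain ⟨n, hn, hNn⟩ := (h.and (eventually_ge_atTop N)).exists
  exact (measure_mono (biInter_subset_of_mem hNn)).trans hn

lemma ae_frequently_separated (hα : (α : ℝ) ≤ 1 / 2) (hreg : ∀ᶠ n in atTop, RegularAt α n W)
    (y : Space 2) :
    ∀ᵐ ω ∂coinMeasure SignIndex, ∃ᶠ n in atTop, ∃ᶠ m in atTop, Separated α y m n ω W := by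
  have hlost : ∀ᶠ n in atTop, coinMeasure SignIndex {ω | ¬∃ᶠ m in atTop, Separated α y m n ω W} ≤
      ∑' k, ENNReal.ofReal (lossBound α (k + n)) := by
    filter_upwards [eventually_forall_ge_atTop.2 hreg] with n hn
    simp only [not_frequently]
    refine measure_eventually_mem_le (s := fun m => {ω | ¬Separated α y m n ω W}) ?_
    filter_upwards [eventually_ge_atTop n] with m hm
    exact measure_not_separated_le hn y hm
  have htail := ENNReal.tendsto_sum_nat_add _ (tsum_lossBound_ne_top hα)
  rw [ae_iff]
  simp only [not_frequently (p := fun n => ∃ᶠ m in atTop, Separated α y m n _ W)]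
  refine le_antisymm (le_of_forall_gt_imp_ge_of_dense fun c hc => ?_) zero_le
  refine measure_eventually_mem_le (s := fun n => {ω | ¬∃ᶠ m in atTop, Separated α y m n ω W}) ?_
  filter_upwards [hlost, htail.eventually_le_const hc] with n hn hc using hn.trans hc

lemma measurableSet_frequently_separated (α : ℝ≥0) (y : Space 2) :
    MeasurableSet {p : SignSpace × Path0 2 1 |
      ∃ᶠ n in atTop, ∃ᶠ m in atTop, Separated α y m n p.1 p.2} := by
  simp only [frequently_atTop, ofPred_forall, ofPred_exists, ofPred_and]
  exact .iInter fun _ => .iUnion fun n => (MeasurableSet.const _).inter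
    (.iInter fun _ => .iUnion fun m => (MeasurableSet.const _).inter
      (measurableSet_separated α y m n))

end FrequentlySeparated

/-! ### Regularity of Hölder and of fractional Brownian paths -/

section Regularity

open Filter

variable {α : ℝ≥0} {n i : ℕ}

lemma block_subset_unitInterval (hi : i < numBlocks α n) :
    Icc (blockStart α n i) (blockStart α n (i + 1)) ⊆ Icc (0 : ℝ) (1 : ℝ≥0) :=
  (block_subset hi).trans (Icc_subset_Icc (stageTime_pos _).le (stageTime_le_one n))

lemma continuous_noise_increment (W : Path0 2 1) (a : ℝ) (c : Fin 2) :
    Continuous fun s => noise W s c - noise W a c :=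
  (continuous_noise_apply W c :).sub continuous_const

lemma measurable_noise_increment (a : ℝ) (c : Fin 2) :
    Measurable fun p : Path0 2 1 × ℝ => noise p.1 p.2 c - noise p.1 a c := by
  have hmeas : Measurable fun p : Path0 2 1 × ℝ => noise p.1 p.2 c :=
    (EuclideanSpace.proj c : Space 2 →L[ℝ] ℝ).measurable.comp measurable_noise
  have hproj : Measurable fun p : Path0 2 1 × ℝ => (p.1, a) :=
    measurable_fst.prodMk measurable_const
  exact hmeas.sub (hmeas.comp hproj :)

lemma eventually_regularAt_of_memHolder {β : ℝ≥0} (hβ1 : β ≤ 1) (hβ : 1 < 2 * (1 - α : ℝ) * β)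
    {W : Path0 2 1} (hW : MemHolder β W) : ∀ᶠ n in atTop, RegularAt α n W := by
  obtain ⟨C, hC⟩ := hW
  filter_upwards [eventually_mul_blockLen_rpow_le β.coe_nonneg (by exact_mod_cast hβ1) hβ C]
    with n hn i hi
  have hle := blockStart_mono α n (Nat.le_succ i)
  have hosc (s : ℝ) (hs : s ∈ Icc (blockStart α n i) (blockStart α n (i + 1))) :
      |noise W s (stageDir n + 1) - noise W (blockStart α n i) (stageDir n + 1)| ≤
        shearScale n / 8 := by
    let s' : Icc (0 : ℝ) (1 : ℝ≥0) := ⟨s, block_subset_unitInterval hi hs⟩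
    let a' : Icc (0 : ℝ) (1 : ℝ≥0) :=
      ⟨blockStart α n i, block_subset_unitInterval hi (left_mem_Icc.2 hle)⟩
    have hdist : dist s' a' ≤ blockLen α n := by
      rw [Subtype.dist_eq, Real.dist_eq, abs_of_nonneg (sub_nonneg.2 hs.1), sub_le_iff_le_add',
        ← blockStart_succ]
      exact hs.2
    calc |noise W s (stageDir n + 1) - noise W (blockStart α n i) (stageDir n + 1)|
        ≤ ‖W s' - W a'‖ := by
          rw [← PiLp.sub_apply, noise_sub_noise W s' a']
          exact PiLp.norm_apply_le (W s' - W a') (stageDir n + 1)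
      _ ≤ C * dist s' a' ^ (β : ℝ) := by rw [← dist_eq_norm]; exact hC.dist_le s' a'
      _ ≤ C * blockLen α n ^ (β : ℝ) := by gcongr
      _ ≤ shearScale n / 8 := hn
  calc blockOscillation α W n i
      ≤ ∫ s in blockStart α n i..blockStart α n (i + 1), shearScale n / 8 :=
        intervalIntegral.integral_mono_on hle
          ((continuous_noise_increment W _ _).abs.intervalIntegrable _ _)
          intervalIntegrable_const hosc
    _ = blockLen α n * shearScale n / 8 := by
        rw [intervalIntegral.integral_const, blockStart_succ, smul_eq_mul]; ring

/-- The absolute moment of order `q` of the standard Gaussian. -/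
def gaussianMoment (q : ℕ) : ℝ≥0∞ := ∫⁻ x, ‖x‖ₑ ^ q ∂gaussianReal 0 1

lemma gaussianMoment_lt_top (q : ℕ) : gaussianMoment q < ∞ := by
  have h := (memLp_id_gaussianReal (μ := 0) (v := 1) q).integrable_norm_pow'.2
  simpa [HasFiniteIntegral, gaussianMoment] using h

lemma lintegral_enorm_pow_gaussianReal (v : ℝ≥0) (q : ℕ) :
    ∫⁻ x, ‖x‖ₑ ^ q ∂gaussianReal 0 v = ENNReal.ofReal √v ^ q * gaussianMoment q := by
  have hscale : gaussianReal 0 v = (gaussianReal 0 1).map (√(v : ℝ) * ·) := by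
    rw [gaussianReal_map_const_mul, mul_zero, mul_one]
    congr 1
    ext
    exact (Real.sq_sqrt v.coe_nonneg).symm
  have hmeas : Measurable fun x : ℝ => ‖x‖ₑ ^ q := by fun_prop
  rw [hscale, lintegral_map hmeas (by fun_prop), gaussianMoment, ← lintegral_const_mul _ hmeas]
  simp only [enorm_mul, mul_pow, Real.enorm_of_nonneg (Real.sqrt_nonneg _)]

section Increments

variable {d : ℕ} {T : ℝ≥0} {H : ℝ} {ν : Measure (Path0 d T)}

lemma hasGaussianLaw_apply (hν : IsFractionalBrownianLaw H ν) (t : Icc (0 : ℝ) T) (c : Fin d) :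
    HasGaussianLaw (fun W : Path0 d T => W t c) ν :=
  (hν.isGaussianProcess.hasGaussianLaw_eval t).map_fun (EuclideanSpace.proj c)

lemma hasGaussianLaw_increment (hν : IsFractionalBrownianLaw H ν) (t s : Icc (0 : ℝ) T)
    (c : Fin d) : HasGaussianLaw (fun W : Path0 d T => (W t - W s) c) ν :=
  (hν.isGaussianProcess.hasGaussianLaw_fun_sub (s := t) (t := s)).map_fun (EuclideanSpace.proj c)

lemma integral_increment (hν : IsFractionalBrownianLaw H ν) (t s : Icc (0 : ℝ) T) (c : Fin d) :
    ∫ W : Path0 d T, (W t - W s) c ∂ν = 0 := by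
  simp only [PiLp.sub_apply]
  rw [integral_sub (hasGaussianLaw_apply hν t c).integrable
    (hasGaussianLaw_apply hν s c).integrable, hν.centered, hν.centered, sub_zero]

lemma variance_increment (hH : H ≠ 0) (hν : IsFractionalBrownianLaw H ν) (t s : Icc (0 : ℝ) T)
    (c : Fin d) : Var[fun W : Path0 d T => (W t - W s) c; ν] = |(t : ℝ) - s| ^ (2 * H) := by
  have hint (t s : Icc (0 : ℝ) T) : Integrable (fun W : Path0 d T => W t c * W s c) ν :=
    (hasGaussianLaw_apply hν t c).memLp_two.integrable_mul (hasGaussianLaw_apply hν s c).memLp_two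
  have hsq (W : Path0 d T) : (W t - W s) c ^ 2 =
      W t c * W t c - 2 * (W t c * W s c) + W s c * W s c := by
    rw [PiLp.sub_apply]; ring
  rw [variance_eq_integral (hasGaussianLaw_increment hν t s c).aemeasurable,
    integral_increment hν]
  simp only [sub_zero, hsq]
  have hint_sub : Integrable (fun W : Path0 d T => W t c * W t c - 2 * (W t c * W s c)) ν :=
    (hint t t).sub ((hint t s).const_mul 2)
  rw [integral_add hint_sub (hint s s),
    integral_sub (hint t t) ((hint t s).const_mul 2), integral_const_mul, hν.covariance,
    hν.covariance, hν.covariance]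
  simp only [if_true, sub_self, abs_zero, Real.zero_rpow (mul_ne_zero two_ne_zero hH)]
  ring

lemma lintegral_enorm_increment_pow (hH : H ≠ 0) (hν : IsFractionalBrownianLaw H ν)
    (t s : Icc (0 : ℝ) T) (c : Fin d) (q : ℕ) :
    ∫⁻ W : Path0 d T, ‖(W t - W s) c‖ₑ ^ q ∂ν =
      ENNReal.ofReal (|(t : ℝ) - s| ^ H) ^ q * gaussianMoment q := by
  have hmeas : Measurable fun x : ℝ => ‖x‖ₑ ^ q := by fun_prop
  have hlaw := hasGaussianLaw_increment hν t s c
  have hsqrt : √(|(t : ℝ) - s| ^ (2 * H)) = |(t : ℝ) - s| ^ H := by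
    rw [mul_comm, Real.rpow_mul (abs_nonneg _), Real.rpow_two,
      Real.sqrt_sq (Real.rpow_nonneg (abs_nonneg _) _)]
  rw [← lintegral_map' hmeas.aemeasurable hlaw.aemeasurable, hlaw.map_eq_gaussianReal,
    integral_increment hν, variance_increment hH hν, lintegral_enorm_pow_gaussianReal,
    Real.coe_toNNReal _ (Real.rpow_nonneg (abs_nonneg _) _), hsqrt]

end Increments

lemma integral_abs_div_pow_le {f : ℝ → ℝ} (hf : Continuous f) {a b : ℝ} (hab : a < b) (q : ℕ) :
    ((∫ s in a..b, |f s|) / (b - a)) ^ q ≤ (∫ s in a..b, |f s| ^ q) / (b - a) := by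
  have hjensen := (convexOn_pow q).map_set_average_le (continuous_pow q).continuousOn isClosed_Ici
    (μ := volume) (t := Ioc a b) (f := fun s => |f s|) (by simpa using hab) (by simp)
    (Eventually.of_forall fun s => abs_nonneg (f s)) hf.abs.integrableOn_Ioc
    (hf.abs.pow q).integrableOn_Ioc
  simpa only [setAverage_eq, Measure.real, Real.volume_Ioc, smul_eq_mul, ← div_eq_inv_mul,
    ENNReal.toReal_ofReal (sub_nonneg.2 hab.le), Function.comp_apply,
    ← intervalIntegral.integral_of_le hab.le] using hjensen

lemma measure_lt_integral_abs_le {β : Type*} [MeasurableSpace β] {μ : Measure β} [SFinite μ]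
    {f : β → ℝ → ℝ} (hf : Measurable (Function.uncurry f)) (hfc : ∀ x, Continuous (f x))
    {a b r : ℝ} (hab : a < b) (hr : 0 < r) {q : ℕ} {M : ℝ≥0∞}
    (hM : ∀ s ∈ Ioc a b, ∫⁻ x, ‖f x s‖ₑ ^ q ∂μ ≤ M) :
    μ {x | (b - a) * r < ∫ s in a..b, |f x s|} ≤ M / ENNReal.ofReal (r ^ q) := by
  have hba := sub_pos.2 hab
  have hmeas : Measurable fun p : β × ℝ => ‖f p.1 p.2‖ₑ ^ q := hf.enorm.pow_const q
  have hsub : {x | (b - a) * r < ∫ s in a..b, |f x s|} ⊆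
      {x | ENNReal.ofReal ((b - a) * r ^ q) ≤ ∫⁻ s in Ioc a b, ‖f x s‖ₑ ^ q} := by
    intro x hx
    have hlt : r < (∫ s in a..b, |f x s|) / (b - a) := (lt_div_iff₀' hba).2 hx
    have hpow := (pow_le_pow_left₀ hr.le hlt.le q).trans (integral_abs_div_pow_le (hfc x) hab q)
    rw [le_div_iff₀' hba, intervalIntegral.integral_of_le hab.le] at hpow
    refine (ENNReal.ofReal_le_ofReal hpow).trans_eq ?_
    have hint : Integrable (fun s => |f x s| ^ q) (volume.restrict (Ioc a b)) :=
      ((hfc x).abs.pow q).integrableOn_Ioc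
    rw [ofReal_integral_eq_lintegral_ofReal hint
      (Eventually.of_forall fun s => by positivity)]
    simp only [ENNReal.ofReal_pow (abs_nonneg _), Real.enorm_eq_ofReal_abs]
  calc μ {x | (b - a) * r < ∫ s in a..b, |f x s|}
      ≤ (∫⁻ x, (∫⁻ s in Ioc a b, ‖f x s‖ₑ ^ q) ∂μ) / ENNReal.ofReal ((b - a) * r ^ q) :=
        (measure_mono hsub).trans (meas_ge_le_lintegral_div
          hmeas.lintegral_prod_right'.aemeasurable
          (ENNReal.ofReal_pos.2 (by positivity)).ne' ENNReal.ofReal_ne_top)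
    _ ≤ ENNReal.ofReal (b - a) * M / ENNReal.ofReal ((b - a) * r ^ q) := by
        gcongr
        rw [lintegral_lintegral_swap hmeas.aemeasurable]
        refine (setLIntegral_mono' measurableSet_Ioc hM).trans_eq ?_
        rw [setLIntegral_const, Real.volume_Ioc, mul_comm]
    _ = M / ENNReal.ofReal (r ^ q) := by
        rw [ENNReal.ofReal_mul hba.le]
        exact ENNReal.mul_div_mul_left _ _ (ENNReal.ofReal_pos.2 hba).ne' ENNReal.ofReal_ne_top

section FractionalBrownian

variable {H : ℝ} {ν : Measure (Path0 2 1)}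

lemma measure_lt_blockOscillation_le (hH : 0 < H) (hν : IsFractionalBrownianLaw H ν)
    (hi : i < numBlocks α n) (q : ℕ) :
    ν {W | blockLen α n * shearScale n / 8 < blockOscillation α W n i} ≤
      ENNReal.ofReal ((8 * (blockLen α n ^ H / shearScale n)) ^ q) * gaussianMoment q := by
  have := hν.isProbabilityMeasure
  have hl := shearScale_pos n
  have hlt : blockStart α n i < blockStart α n (i + 1) := by
    rw [blockStart_succ]; exact lt_add_of_pos_right _ (blockLen_pos α n)
  have hlen : blockStart α n (i + 1) - blockStart α n i = blockLen α n := by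
    rw [blockStart_succ, add_sub_cancel_left]
  have hpow : 0 ≤ blockLen α n ^ H := Real.rpow_nonneg (blockLen_pos α n).le _
  have hmoment (s : ℝ) (hs : s ∈ Ioc (blockStart α n i) (blockStart α n (i + 1))) :
      ∫⁻ W, ‖noise W s (stageDir n + 1) - noise W (blockStart α n i) (stageDir n + 1)‖ₑ ^ q ∂ν ≤
        ENNReal.ofReal (blockLen α n ^ H) ^ q * gaussianMoment q := by
    have h := lintegral_enorm_increment_pow hH.ne' hν
      ⟨s, block_subset_unitInterval hi (Ioc_subset_Icc_self hs)⟩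
      ⟨_, block_subset_unitInterval hi (left_mem_Icc.2 hlt.le)⟩ (stageDir n + 1) q
    simp only [← noise_sub_noise] at h
    refine h.trans_le ?_
    rw [abs_of_pos (sub_pos.2 hs.1), ← hlen]
    gcongr
    · exact sub_nonneg.2 hs.1.le
    · exact hs.2
  have hmarkov := measure_lt_integral_abs_le (μ := ν)
    (f := fun W s => noise W s (stageDir n + 1) - noise W (blockStart α n i) (stageDir n + 1))
    (measurable_noise_increment (blockStart α n i) (stageDir n + 1))
    (fun W => continuous_noise_increment W (blockStart α n i) (stageDir n + 1)) hlt
    (by positivity : 0 < shearScale n / 8) hmoment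
  rw [hlen, ← mul_div_assoc] at hmarkov
  refine hmarkov.trans_eq ?_
  rw [ENNReal.mul_div_right_comm, ← ENNReal.ofReal_pow hpow,
    ← ENNReal.ofReal_div_of_pos (by positivity), ← div_pow, div_div_eq_mul_div, mul_comm _ (8 : ℝ),
    mul_div_assoc]

lemma measure_not_regularAt_le (hH : 0 < H) (hν : IsFractionalBrownianLaw H ν) (α : ℝ≥0)
    (n q : ℕ) : ν {W | ¬RegularAt α n W} ≤
      ENNReal.ofReal (numBlocks α n * (8 * (blockLen α n ^ H / shearScale n)) ^ q) *
        gaussianMoment q := by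
  have hunion : {W | ¬RegularAt α n W} ⊆ ⋃ i ∈ Finset.range (numBlocks α n),
      {W | blockLen α n * shearScale n / 8 < blockOscillation α W n i} := fun W hW => by
    simpa [RegularAt] using hW
  calc ν {W | ¬RegularAt α n W}
      ≤ ∑ i ∈ Finset.range (numBlocks α n),
          ν {W | blockLen α n * shearScale n / 8 < blockOscillation α W n i} :=
        (measure_mono hunion).trans (measure_biUnion_finset_le _ _)
    _ ≤ ∑ _ ∈ Finset.range (numBlocks α n),
          ENNReal.ofReal ((8 * (blockLen α n ^ H / shearScale n)) ^ q) * gaussianMoment q :=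
        Finset.sum_le_sum fun i hi =>
          measure_lt_blockOscillation_le hH hν (Finset.mem_range.1 hi) q
    _ = _ := by
        rw [Finset.sum_const, Finset.card_range, nsmul_eq_mul,
          ENNReal.ofReal_mul (Nat.cast_nonneg _), ENNReal.ofReal_natCast, mul_assoc]

lemma ae_eventually_regularAt (hH0 : 0 < H) (hH1 : H ≤ 1) (hH : 1 < 2 * (1 - α : ℝ) * H)
    (hν : IsFractionalBrownianLaw H ν) : ∀ᵐ W ∂ν, ∀ᶠ n in atTop, RegularAt α n W := by
  obtain ⟨q, hq⟩ := exists_summable_numBlocks_mul hH0.le hH1 hH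
  have hsum : ∑' n, ν {W | ¬RegularAt α n W} ≠ ∞ := by
    refine ne_top_of_le_ne_top ?_
      (ENNReal.tsum_le_tsum fun n => measure_not_regularAt_le hH0 hν α n q)
    rw [ENNReal.tsum_mul_right]
    exact ENNReal.mul_ne_top hq.tsum_ofReal_ne_top (gaussianMoment_lt_top q).ne
  filter_upwards [ae_eventually_notMem hsum] with W hW
  simpa using hW

end FractionalBrownian

end Regularity

section Nonuniqueness

open Filter

variable {α : ℝ≥0}

lemma ae_hasNonuniqueSolutions (hα : (α : ℝ) ≤ 1 / 2) {W : Path0 2 1}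
    (hreg : ∀ᶠ n in atTop, RegularAt α n W) (y : Space 2) :
    ∀ᵐ ω ∂coinMeasure SignIndex, ∀ (ε : ℝ≥0) (hε : ε ≤ 1), 0 < ε →
      HasNonuniqueSolutions (velocity α ω) y (restrictPath hε W) := by
  filter_upwards [ae_frequently_separated hα hreg y] with ω hω ε hε hε0
  exact hasNonuniqueSolutions_of_frequently_separated hω hε hε0

lemma continuous_restrictPath {d : ℕ} {T ε : ℝ≥0} (h : ε ≤ T) :
    Continuous (restrictPath h : Path0 d T → Path0 d ε) :=
  ContinuousMap.continuous_precomp _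

lemma ae_not_pathByPathUniqueness (hα : (α : ℝ) ≤ 1 / 2) {ν : Measure (Path0 2 1)}
    [IsProbabilityMeasure ν] (hreg : ∀ᵐ W ∂ν, ∀ᶠ n in atTop, RegularAt α n W) (y : Space 2) :
    ∀ᵐ ω ∂coinMeasure SignIndex, ∀ (ε : ℝ≥0) (hε : ε ≤ 1), 0 < ε →
      ¬PathByPathUniqueness (velocity α ω) y (ν.map (restrictPath hε)) := by
  have hsep : ∀ᵐ ω ∂coinMeasure SignIndex, ∀ᵐ W ∂ν,
      ∃ᶠ n in atTop, ∃ᶠ m in atTop, Separated α y m n ω W :=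
    (Measure.ae_ae_comm (measurableSet_frequently_separated α y)).2
      (hreg.mono fun _ hW => ae_frequently_separated hα hW y)
  filter_upwards [hsep] with ω hω ε hε hε0 huniq
  have huniq' := ae_of_ae_map (continuous_restrictPath hε).measurable.aemeasurable huniq
  obtain ⟨W, hW, hunique⟩ := (hω.and huniq').exists
  obtain ⟨X₁, X₂, hX₁, hX₂, hne⟩ := hasNonuniqueSolutions_of_frequently_separated hW hε hε0
  exact hne (hunique.unique hX₁ hX₂)

end Nonuniqueness

end

theorem corollary1p7 (α : ℝ≥0) (hα : (α : ℝ) < 1 / 2) :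
    ∃ (Ω : Type) (_ : MeasurableSpace Ω) (P : Measure Ω) (_ : IsProbabilityMeasure P)
      (u : Ω → ℝ → (Space 2 →ᵇ Space 2)),
      IsRandomVelocityField 1 u ∧
      (∀ ω, ∀ t ∈ Icc (0 : ℝ) 1, holderNorm α (u ω t) ≤ 2) ∧
      (∀ β : ℝ≥0, 1 / (2 * (1 - (α : ℝ))) < (β : ℝ) → β ≤ 1 →
        ∀ W : Path0 2 1, MemHolder β W → ∀ y : Space 2,
          ∀ᵐ ω ∂P, ∀ (ε : ℝ≥0) (hε : ε ≤ 1), 0 < ε →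
            HasNonuniqueSolutions (u ω) y (restrictPath hε W)) ∧
      (∀ H : ℝ, 0 < H → H < 1 → (α : ℝ) < 1 - 1 / (2 * H) →
        ∀ ν : Measure (Path0 2 1), IsFractionalBrownianLaw H ν → ∀ y : Space 2,
          ∀ᵐ ω ∂P, ∀ (ε : ℝ≥0) (hε : ε ≤ 1), 0 < ε →
            ¬ PathByPathUniqueness (u ω) y (ν.map (restrictPath hε))) := by
  have hα1 : α ≤ 1 := by rw [← NNReal.coe_le_coe, NNReal.coe_one]; linarith
  refine ⟨SignSpace, inferInstance, coinMeasure SignIndex, inferInstance, velocity α,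
    isRandomVelocityField_velocity α 1, fun ω t _ => holderNorm_velocity_le hα1 ω t, ?_, ?_⟩
  · intro β hβ hβ1 W hW y
    have hβ' : 1 < 2 * (1 - (α : ℝ)) * β := by
      rwa [div_lt_iff₀' (by linarith)] at hβ
    exact ae_hasNonuniqueSolutions hα.le (eventually_regularAt_of_memHolder hβ1 hβ' hW) y
  · intro H hH0 hH1 hH ν hν y
    have := hν.isProbabilityMeasure
    have hH' : 1 < 2 * (1 - (α : ℝ)) * H := by
      rw [lt_sub_comm, div_lt_iff₀ (by positivity)] at hH
      linarith
    exact ae_not_pathByPathUniqueness hα.le (ae_eventually_regularAt hH0 hH1.le hH' hν) y
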